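/- Let $G=(\mathcal V,\mathcal E)$ be a finite connected multigraph, i.e. a graph with simple edges in which self-loops are allowed; write $u - v$ if $\{u,v\}\in\mathcal E$. Let $\mathcal V_2$ be the set of nodes without a self-loop, and for $U\subset\mathcal V$ put $\mathcal E(U)=\{v\in\mathcal V : \exists u\in U,\ u - v\}$. Let $\check G$ be the maximal subgraph of $G$, obtained by deleting all self-loops, and let $\mathbb I(G)$, $\mathbb I(\check G)$ be the sets of non-empty independent sets of $G$ and of $\check G$ (sets of nodes containing no edge; in particular the elements of $\mathbb I(G)$ contain no node with a self-loop). Let $\mathscr M(\mathcal V)$ be the set of probability measures on $\mathcal V$ with exact support $\mathcal V$, and $$\textsc{Ncond}(G)=\{\mu\in\mathscr M(\mathcal V) : \mu(I)<\mu(\mathcal E(I))\ \text{ for all } I\in\mathbb I(G)\}.$$ Items whose classes $V_1,V_2,\dots$ are i.i.d. with law $\mu\in\mathscr M(\mathcal V)$ arrive one by one. Under the policy First Come, First Matched (FCFM), an arriving item of class $v$ is matched with the oldest item in the buffer whose class $u$ satisfies $u - v$, and both leave; if there is no such item, the arriving item is stored at the end of the line. The buffer content $W_n$ is the word of the classes of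 the stored items after the $n$-th arrival, in order of arrival. It is a Markov chain on the set $\mathbb W$ of the finite words over $\mathcal V$ in which two distinct adjacent classes never both occur and a class with a self-loop occurs at most once; $\varepsilon$ is the empty word. Let $\textsc{Stab}(G,\textsc{fcfm})$ be the set of all $\mu\in\mathscr M(\mathcal V)$ for which $(W_n)$ is positive recurrent. Suppose that $G$ is not a bipartite graph (that is, $G$ has a self-loop, or it has none and is not bipartite). Then FCFM is maximal: $$\textsc{Stab}(G,\textsc{fcfm})=\textsc{Ncond}(G).$$ Moreover, for every $\mu\in\textsc{Ncond}(G)$ the chain $(W_n)$ has a unique stationary probability $\Pi_W$ on $\mathbb W$, and it is given by $$\Pi_W(\varepsilon)=\alpha,\qquad \Pi_W(w)=\alpha\prod_{l=1}^{q}\frac{\mu(w_l)}{\mu(\mathcal E(\{w_1,\dots,w_l\}))}\quad\text{for } w=w_1\cdots w_q\in\mathbb W\setminus\{\varepsilon\},$$ where, writing $I=\{e_1,\dots,e_{|I|}\}$ for $I\in\mathbb I(\check G)$ and $\mathfrak S_k$ for the set of permutations of $\{1,\dots,k\}$, $$\alpha^{-1}=1+\sum_{I\in\mathbb I(\check G)}\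 \sum_{\sigma\in\mathfrak S_{|I|}}\ \prod_{i=1}^{|I|}\frac{\mu(e_{\sigma(i)})}{\mu(\mathcal E(\{e_{\sigma(1)},\dots,e_{\sigma(i)}\}))-\mu(\{e_{\sigma(1)},\dots,e_{\sigma(i)}\}\cap\mathcal V_2)}.$$ -/

import Mathlib

open scoped ENNReal Finset
open MeasureTheory

noncomputable section

open scoped Classical

/-- A multigraph on the vertex set `V`: self-loops are allowed, all edges are simple.
The relation `G.Adj u v` says that `{u, v}` is an edge (a self-loop if `u = v`). -/
structure Multigraph (V : Type*) where
  Adj : V → V → Prop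
  symm : ∀ u v, Adj u v → Adj v u

namespace Multigraph

variable {V : Type*}

/-- Any two nodes are joined by a path of edges (and there is at least one node). -/
def Connected (G : Multigraph V) : Prop :=
  Nonempty V ∧ ∀ u v : V, Relation.ReflTransGen G.Adj u v

/-- The maximal subgraph `Ǧ`: the simple graph obtained by deleting all self-loops. -/
def maxSubgraph (G : Multigraph V) : SimpleGraph V where
  Adj u v := u ≠ v ∧ G.Adj u v
  symm := ⟨fun _ _ h => ⟨h.1.symm, G.symm _ _ h.2⟩⟩
  loopless := ⟨fun _ h => h.1 rfl⟩

/-- `G` is a graph (it has no self-loop), and this graph is bipartite. -/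
def IsBipartiteGraph (G : Multigraph V) : Prop :=
  (∀ v, ¬ G.Adj v v) ∧ G.maxSubgraph.IsBipartite

/-- Admissible queue details: two distinct compatible classes are never both present, and a class
with a self-loop is present at most once. -/
def IsQueueDetail (G : Multigraph V) (w : List V) : Prop :=
  (∀ i j, i ≠ j → G.Adj i j → w.count i * w.count j = 0) ∧ ∀ i, G.Adj i i → w.count i ≤ 1

/-- The state space `𝕎` of admissible queue details. -/
abbrev QueueDetail (G : Multigraph V) : Type _ := {w : List V // G.IsQueueDetail w}

/-- The First Come, First Matched update of a word: the incoming `v`-item is matched with the oldest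
compatible item (which leaves), and is stored at the end of the line if there is none. -/
def fcfmWord (G : Multigraph V) (w : List V) (v : V) : List V :=
  if ∃ u ∈ w, G.Adj u v then w.eraseP (fun u => decide (G.Adj u v)) else w ++ [v]

theorem IsQueueDetail.fcfmWord {G : Multigraph V} {w : List V} (hw : G.IsQueueDetail w) (v : V) :
    G.IsQueueDetail (G.fcfmWord w v) := by
  unfold Multigraph.fcfmWord
  split_ifs with h
  · have hle : ∀ i, (w.eraseP (fun u => decide (G.Adj u v))).count i ≤ w.count i :=
      fun i => List.eraseP_sublist.count_le i
    refine ⟨fun i j hij ha => ?_, fun i hi => (hle i).trans (hw.2 i hi)⟩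
    exact Nat.le_zero.1 ((Nat.mul_le_mul (hle i) (hle j)).trans (hw.1 i j hij ha).le)
  · have h0 : ∀ u, G.Adj u v → w.count u = 0 := fun u hu =>
      List.count_eq_zero.2 fun hm => h ⟨u, hm, hu⟩
    refine ⟨fun i j hij ha => ?_, fun i hi => ?_⟩
    · by_cases hj : v = j
      · subst hj
        simp [h0 i ha, Ne.symm hij]
      · by_cases hi : v = i
        · subst hi
          simp [h0 j (G.symm _ _ ha), hj]
        · simpa [List.count_append, List.count_singleton, hi, hj] using hw.1 i j hij ha
    · by_cases hv : v = i
      · subst hv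
        simp [h0 v hi]
      · simpa [List.count_append, List.count_singleton, hv] using hw.2 i hi

/-- A (deterministic) matching policy, given by its action on queue details:
`Φ w v` is the new queue detail if a `v`-item arrives at the queue detail `w`. -/
abbrev Policy (G : Multigraph V) : Type _ := G.QueueDetail → V → G.QueueDetail

/-- The policy First Come, First Matched. -/
def fcfm (G : Multigraph V) : G.Policy := fun w v => ⟨G.fcfmWord w.1 v, w.2.fcfmWord v⟩

/-- The buffer content `W_n` at time `n`, started from `w`; the `n`-th item (`n ≥ 1`) has
class `a (n - 1)`. -/
def buffer {G : Multigraph V} (Φ : G.Policy) (w : G.QueueDetail) (a : ℕ → V) : ℕ → G.QueueDetail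
  | 0 => w
  | n + 1 => Φ (buffer Φ w a n) (a n)

/-- The first return time to `w` of the buffer content started from `w` (`∞` if it does not
return). -/
def returnTime {G : Multigraph V} (Φ : G.Policy) (w : G.QueueDetail) (a : ℕ → V) : ℝ≥0∞ :=
  ⨅ (n : ℕ) (_ : 1 ≤ n ∧ buffer Φ w a n = w), (n : ℝ≥0∞)

/-- The law of the i.i.d. sequence of the classes of the arriving items. -/
def arrivals [MeasurableSpace V] (μ : PMF V) : Measure (ℕ → V) :=
  Measure.infinitePi fun _ : ℕ => μ.toMeasure

/-- The buffer-content chain is positive recurrent: the mean return time of every state is finite. -/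
def PositiveRecurrent [MeasurableSpace V] {G : Multigraph V} (Φ : G.Policy) (μ : PMF V) : Prop :=
  ∀ w : G.QueueDetail, ∫⁻ a, returnTime Φ w a ∂(arrivals μ) < ∞

/-- The set `ℳ(V)` of the probability measures with exact support `V`. -/
def exactSupport (V : Type*) : Set (PMF V) := {μ | μ.support = Set.univ}

/-- The stability region. -/
def Stab [MeasurableSpace V] (G : Multigraph V) (Φ : G.Policy) : Set (PMF V) :=
  {μ | μ ∈ exactSupport V ∧ PositiveRecurrent Φ μ}

/-- `π` is a stationary probability of the buffer-content chain. -/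
def IsStationary {G : Multigraph V} (Φ : G.Policy) (μ : PMF V) (π : PMF G.QueueDetail) : Prop :=
  π.bind (fun w => μ.map (Φ w)) = π

/-- The mass `μ(A)`, as a real number. -/
def mass (μ : PMF V) (A : Finset V) : ℝ := ∑ v ∈ A, (μ v).toReal

/-- The set `{x_1, …, x_i}` of the first letters of a word. -/
def firsts {n : ℕ} (x : Fin n → V) (i : Fin n) : Finset V := (Finset.Iic i).image x

variable [Fintype V]

/-- The neighbourhood `ℰ(U)`. -/
def nbhd (G : Multigraph V) (U : Finset V) : Finset V := {v | ∃ u ∈ U, G.Adj u v}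

/-- The set `V₂` of the nodes without self-loop. -/
def loopless (G : Multigraph V) : Finset V := {v | ¬ G.Adj v v}

/-- The (nonempty) independent sets of the multigraph `G`. -/
def indepSets (G : Multigraph V) : Finset (Finset V) :=
  {I | I.Nonempty ∧ ∀ u ∈ I, ∀ v ∈ I, ¬ G.Adj u v}

/-- The (nonempty) independent sets of the maximal subgraph of `G`. -/
def maxSubgraphIndepSets (G : Multigraph V) : Finset (Finset V) :=
  {I | I.Nonempty ∧ G.maxSubgraph.IsIndepSet (I : Set V)}

/-- The set `Ncond(G)`. -/
def Ncond (G : Multigraph V) : Set (PMF V) :=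
  {μ | μ ∈ exactSupport V ∧ ∀ I ∈ G.indepSets, mass μ I < mass μ (G.nbhd I)}

/-- An enumeration `e_1, …, e_{|I|}` of the finite set `I`. -/
def enum (I : Finset V) (i : Fin #I) : V := I.equivFin.symm i

/-- The normalising constant `α`. -/
def normConst (G : Multigraph V) (μ : PMF V) : ℝ :=
  (1 + ∑ I ∈ G.maxSubgraphIndepSets, ∑ σ : Equiv.Perm (Fin #I), ∏ i : Fin #I,
    (μ (enum I (σ i))).toReal /
      (mass μ (G.nbhd (firsts (fun j => enum I (σ j)) i)) -
        mass μ (firsts (fun j => enum I (σ j)) i ∩ G.loopless)))⁻¹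

/-- The product `∏_l μ(w_l) / μ(ℰ({w_1, …, w_l}))`. -/
def wordWeight (G : Multigraph V) (μ : PMF V) (w : List V) : ℝ :=
  ∏ l : Fin w.length, (μ (w.get l)).toReal / mass μ (G.nbhd (firsts w.get l))

end Multigraph

end

/-! Sufficiency rests on the product form. Put p(w) = ∏ μ(w_l)/μ(ℰ({w_1, …, w_l})). A word w is
entered either by storing its last letter, with flow at most p(w)μ(ℰ(w)), or by removing a letter u
∉ ℰ(w) from some position. For fixed u, the flows over all positions telescope to p(w)μ(u)
(`sum_listWeight_insert`), so all u ∉ ℰ(w) together contribute at most p(w)(1 - μ(ℰ(w))). Hence p is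
subinvariant, and a subinvariant probability is invariant because one step preserves total mass.

The total mass of p is finite under `Ncond`: once the set of letters seen is S, the letters that can
be repeated are those of S without loop, with total weight μ(S ∩ V₂)/μ(ℰ(S)) < 1. Summing these
geometric series turns the sum over admissible words into the finite sum over orderings of
independent sets of Ǧ that defines α. A stationary probability that charges every state bounds all
mean return times, by an inequality of Kac type. It is unique because the empty word is reachable
from everywhere.

Necessity: if μ(I) ≥ μ(ℰ(I)) for an independent I, the number of I-letters minus the number of
ℰ(I)-letters is a submartingale, zero at the empty word. As G is connected and not bipartite, some j
∈ ℰ(I) has a neighbour k ∉ I, and the drift at the one-letter word j is strictly positive. So its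
expectation on the event of no return to the empty word stays above some c > 0, while it is at most
n times the probability of no return within n steps. That probability is then at least c/n, and the
mean return time is infinite. -/

noncomputable section

open scoped Classical

namespace Multigraph

variable {V : Type*}

/-! ### Return times, stationary probabilities and their uniqueness -/

section Chain

variable {G : Multigraph V}

/-- The sequence with first term `v`, followed by the sequence `a`. -/
def consSeq (v : V) (a : ℕ → V) : ℕ → V
  | 0 => v
  | n + 1 => a n

theorem buffer_consSeq (Φ : G.Policy) (x : G.QueueDetail) (v : V) (a : ℕ → V) (n : ℕ) :
    buffer Φ x (consSeq v a) (n + 1) = buffer Φ (Φ x v) a n := by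
  induction n with
  | zero => rfl
  | succ n ih => rw [buffer, ih]; rfl

/-- The first `n` steps of the buffer content started from `x` avoid the state `w`. -/
def Avoids (Φ : G.Policy) (w x : G.QueueDetail) (n : ℕ) (a : ℕ → V) : Prop :=
  ∀ k, 1 ≤ k → k ≤ n → buffer Φ x a k ≠ w

theorem avoids_consSeq_succ (Φ : G.Policy) (w x : G.QueueDetail) (n : ℕ) (v : V) (a : ℕ → V) :
    Avoids Φ w x (n + 1) (consSeq v a) ↔ Φ x v ≠ w ∧ Avoids Φ w (Φ x v) n a := by
  constructor
  · intro h
    refine ⟨by simpa [buffer, consSeq] using h 1 le_rfl (by omega), fun k hk hkn => ?_⟩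
    simpa [buffer_consSeq] using h (k + 1) (by omega) (by omega)
  · rintro ⟨h0, h⟩ k hk hkn
    obtain ⟨k, rfl⟩ : ∃ j, k = j + 1 := ⟨k - 1, by omega⟩
    rw [buffer_consSeq]
    rcases Nat.eq_zero_or_pos k with rfl | hk'
    · exact h0
    · exact h k hk' (by omega)

/-- A return time N is the number of n < N, and n < N means that no return has occurred by time n.
The term n = 0 is always 1. -/
theorem returnTime_eq_tsum (Φ : G.Policy) (w : G.QueueDetail) (a : ℕ → V) :
    returnTime Φ w a = ∑' n : ℕ, if Avoids Φ w w n a then 1 else 0 := by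
  by_cases h : ∃ n, 1 ≤ n ∧ buffer Φ w a n = w
  · have hN := Nat.find_spec h
    have hmin := fun m (hm : m < Nat.find h) => Nat.find_min h hm
    set N := Nat.find h with hNdef
    have h1 : returnTime Φ w a = N := by
      refine le_antisymm (iInf₂_le N hN) (le_iInf₂ fun n hn => ?_)
      exact_mod_cast Nat.find_min' h hn
    have h2 : ∀ n, Avoids Φ w w n a ↔ n < N := by
      intro n
      constructor
      · intro hn
        by_contra hc
        exact hn N hN.1 (not_lt.1 hc) hN.2
      · intro hn k hk hkn hkw
        exact hmin k (by omega) ⟨hk, hkw⟩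
    rw [h1]
    simp only [h2]
    rw [tsum_eq_sum (s := Finset.range N)]
    · rw [Finset.sum_congr rfl (fun n hn => if_pos (Finset.mem_range.1 hn))]
      simp
    · intro n hn
      simpa using hn
  · push Not at h
    have h1 : returnTime Φ w a = ∞ := by
      simp only [returnTime, iInf_eq_top]
      intro n hn
      exact absurd hn.2 (h n hn.1)
    have h2 : ∀ n, Avoids Φ w w n a := fun n k hk _ => h k hk
    rw [h1]
    simp only [h2, if_true]
    exact (ENNReal.tsum_const_eq_top_of_ne_zero one_ne_zero).symm

section ArrivalSequence

variable [MeasurableSpace V]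

theorem measurable_consSeq : Measurable fun p : V × (ℕ → V) => consSeq p.1 p.2 := by
  refine measurable_pi_lambda _ fun n => ?_
  cases n with
  | zero => exact measurable_fst
  | succ n => exact (measurable_pi_apply n).comp measurable_snd

/-- Prepending an independent letter preserves the i.i.d. law, as is checked on cylinders. This is
the source of the Markov property used below. -/
theorem map_consSeq_arrivals (μ : PMF V) :
    (μ.toMeasure.prod (arrivals μ)).map (fun p => consSeq p.1 p.2) = arrivals μ := by
  have hp : IsProbabilityMeasure (arrivals μ) := by unfold arrivals; infer_instance
  refine Measure.eq_infinitePi _ fun s t ht => ?_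
  rw [Measure.map_apply measurable_consSeq (MeasurableSet.pi s.countable_toSet fun i _ => ht i)]
  -- The constrained coordinates other than 0, shifted down by one; coordinate 0 is the prepended
  -- letter.
  set s' : Finset ℕ := s.preimage Nat.succ (Nat.succ_injective.injOn) with hs'
  have hpre : (fun p : V × (ℕ → V) => consSeq p.1 p.2) ⁻¹' Set.pi s t =
      (if 0 ∈ s then t 0 else Set.univ) ×ˢ Set.pi s' (fun i => t (i + 1)) := by
    ext ⟨v, a⟩
    simp only [Set.mem_preimage, Set.mem_pi, Set.mem_prod, Finset.mem_coe]
    constructor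
    · intro h
      refine ⟨?_, fun i hi => h (i + 1) (by simpa [hs'] using hi)⟩
      split_ifs with h0
      · exact h 0 h0
      · trivial
    · rintro ⟨h0, h⟩ i hi
      cases i with
      | zero => simpa [hi, consSeq] using h0
      | succ i => exact h i (by simpa [hs'] using hi)
  rw [hpre, Measure.prod_prod, arrivals, Measure.infinitePi_pi _ (fun i _ => ht _)]
  have hprod : ∏ i ∈ s', μ.toMeasure (t (i + 1)) = ∏ i ∈ s.erase 0, μ.toMeasure (t i) := by
    refine Finset.prod_bij (fun i _ => i + 1) ?_ ?_ ?_ ?_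
    · intro i hi; simpa [hs'] using hi
    · intro i _ j _ h; omega
    · intro j hj
      obtain ⟨h0, hj⟩ := Finset.mem_erase.1 hj
      obtain ⟨i, rfl⟩ := Nat.exists_eq_succ_of_ne_zero h0
      exact ⟨i, by simpa [hs'] using hj, rfl⟩
    · intro i _; rfl
  rw [hprod]
  split_ifs with h0
  · exact Finset.mul_prod_erase s (fun i => μ.toMeasure (t i)) h0
  · rw [measure_univ, one_mul, Finset.erase_eq_of_notMem h0]

end ArrivalSequence

/-! ### First-step analysis, invariant measures and Kac's inequality -/

variable [Fintype V]

/-- The probability that the buffer content started from `x` avoids `w` during `n` steps. -/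
def avoidProb (Φ : G.Policy) (μ : PMF V) (w : G.QueueDetail) : ℕ → G.QueueDetail → ℝ≥0∞
  | 0, _ => 1
  | n + 1, x => ∑ v, μ v * if Φ x v = w then 0 else avoidProb Φ μ w n (Φ x v)

section Measure

variable [MeasurableSpace V] [MeasurableSingletonClass V]

theorem lintegral_arrivals (μ : PMF V) {F : (ℕ → V) → ℝ≥0∞} (hF : Measurable F) :
    ∫⁻ a, F a ∂(arrivals μ) = ∑ v, μ v * ∫⁻ a, F (consSeq v a) ∂(arrivals μ) := by
  have hp : IsProbabilityMeasure (arrivals μ) := by unfold arrivals; infer_instance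
  conv_lhs => rw [← map_consSeq_arrivals μ]
  rw [lintegral_map hF measurable_consSeq,
    lintegral_prod (fun p : V × (ℕ → V) => F (consSeq p.1 p.2))
      (hF.comp measurable_consSeq).aemeasurable, lintegral_fintype]
  refine Finset.sum_congr rfl fun v _ => ?_
  rw [PMF.toMeasure_apply_singleton _ _ (measurableSet_singleton v), mul_comm]

theorem measurableSet_buffer_eq (Φ : G.Policy) (x w : G.QueueDetail) (n : ℕ) :
    MeasurableSet {a : ℕ → V | buffer Φ x a n = w} := by
  induction n generalizing w with
  | zero => simp only [buffer]; exact MeasurableSet.const _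
  | succ n ih =>
    have : {a : ℕ → V | buffer Φ x a (n + 1) = w} =
        ⋃ (y : G.QueueDetail) (v : V) (_ : Φ y v = w),
          {a | buffer Φ x a n = y} ∩ {a | a n = v} := by
      ext a
      simp [buffer]
    rw [this]
    refine MeasurableSet.iUnion fun y => MeasurableSet.iUnion fun v => MeasurableSet.iUnion
      fun _ => (ih y).inter ?_
    exact (measurable_pi_apply (X := fun _ => V) n) (measurableSet_singleton v)

theorem measurableSet_avoids (Φ : G.Policy) (w x : G.QueueDetail) (n : ℕ) :
    MeasurableSet {a : ℕ → V | Avoids Φ w x n a} := by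
  have : {a : ℕ → V | Avoids Φ w x n a} =
      ⋂ (k : ℕ) (_ : 1 ≤ k) (_ : k ≤ n), {a | buffer Φ x a k = w}ᶜ := by
    ext a
    simp [Avoids]
  rw [this]
  exact MeasurableSet.iInter fun k => MeasurableSet.iInter fun _ => MeasurableSet.iInter
    fun _ => (measurableSet_buffer_eq Φ x w k).compl

theorem lintegral_avoids (Φ : G.Policy) (μ : PMF V) (w : G.QueueDetail) (n : ℕ)
    (x : G.QueueDetail) :
    ∫⁻ a, (if Avoids Φ w x n a then 1 else 0) ∂(arrivals μ) = avoidProb Φ μ w n x := by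
  have hp : IsProbabilityMeasure (arrivals μ) := by unfold arrivals; infer_instance
  induction n generalizing x with
  | zero =>
    have : ∀ a : ℕ → V, Avoids Φ w x 0 a := fun a k h1 h2 => by omega
    simp [this, avoidProb]
  | succ n ih =>
    rw [lintegral_arrivals μ
      (Measurable.ite (measurableSet_avoids Φ w x (n + 1)) measurable_const measurable_const),
      avoidProb]
    refine Finset.sum_congr rfl fun v _ => ?_
    congr 1
    simp only [avoids_consSeq_succ]
    split_ifs with h
    · simp [h]
    · simpa [h] using ih (Φ x v)

/-- The mean return time is the sum of the tail probabilities. -/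
theorem lintegral_returnTime (Φ : G.Policy) (μ : PMF V) (w : G.QueueDetail) :
    ∫⁻ a, returnTime Φ w a ∂(arrivals μ) = ∑' n, avoidProb Φ μ w n w := by
  simp only [returnTime_eq_tsum]
  rw [lintegral_tsum fun n => (Measurable.ite (measurableSet_avoids Φ w w n) measurable_const
    measurable_const).aemeasurable]
  simp only [lintegral_avoids]

end Measure

/-- The image of the measure with weights `f` under one step of the chain. -/
def stepMass (Φ : G.Policy) (μ : PMF V) (f : G.QueueDetail → ℝ≥0∞) (w : G.QueueDetail) : ℝ≥0∞ :=
  ∑' x, f x * ∑ v, if Φ x v = w then μ v else 0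

theorem isStationary_iff (Φ : G.Policy) (μ : PMF V) (π : PMF G.QueueDetail) :
    IsStationary Φ μ π ↔ ∀ w, stepMass Φ μ π w = π w := by
  have : ∀ w, (π.bind fun w => μ.map (Φ w)) w = stepMass Φ μ π w := by
    intro w
    rw [PMF.bind_apply]
    refine tsum_congr fun x => ?_
    rw [PMF.map_apply, tsum_fintype]
    congr 1
    exact Finset.sum_congr rfl fun v _ => by
      by_cases h : Φ x v = w
      · rw [if_pos h, if_pos h.symm]
      · rw [if_neg h, if_neg (Ne.symm h)]
  rw [IsStationary, PMF.ext_iff]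
  simp only [this]

/-- Duality between the action of the kernel on measures and on functions, by Tonelli. -/
theorem tsum_stepMass_mul (Φ : G.Policy) (μ : PMF V) (f h : G.QueueDetail → ℝ≥0∞) :
    ∑' w, stepMass Φ μ f w * h w = ∑' x, f x * ∑ v, μ v * h (Φ x v) := by
  simp only [stepMass, ← ENNReal.tsum_mul_right]
  rw [ENNReal.tsum_comm]
  refine tsum_congr fun x => ?_
  simp only [mul_assoc, ENNReal.tsum_mul_left, Finset.sum_mul]
  congr 1
  rw [Summable.tsum_finsetSum fun _ _ => ENNReal.summable]
  refine Finset.sum_congr rfl fun v _ => ?_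
  rw [tsum_eq_single (Φ x v)]
  · simp
  · intro w hw
    simp [Ne.symm hw]

theorem tsum_stepMass (Φ : G.Policy) (μ : PMF V) (f : G.QueueDetail → ℝ≥0∞) :
    ∑' w, stepMass Φ μ f w = ∑' x, f x := by
  have h := tsum_stepMass_mul Φ μ f (fun _ => 1)
  have hμ : ∑ v, μ v = 1 := by rw [← tsum_fintype (L := .unconditional _)]; exact μ.tsum_coe
  simpa [hμ] using h

theorem eq_of_le_of_tsum_eq {X : Type*} {f g : X → ℝ≥0∞} (hle : ∀ x, f x ≤ g x)
    (hsum : ∑' x, g x ≤ ∑' x, f x) (hfin : ∑' x, f x ≠ ∞) (x : X) : f x = g x := by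
  refine le_antisymm (hle x) ?_
  by_contra hlt
  have hlt : f x < g x := not_le.1 hlt
  exact absurd hsum (not_le.2 (ENNReal.tsum_lt_tsum hfin hle hlt))

/-- A subinvariant probability is stationary. -/
theorem isStationary_of_stepMass_le (Φ : G.Policy) (μ : PMF V) (π : PMF G.QueueDetail)
    (h : ∀ w, stepMass Φ μ π w ≤ π w) : IsStationary Φ μ π := by
  rw [isStationary_iff]
  refine eq_of_le_of_tsum_eq h (tsum_stepMass Φ μ π).ge ?_
  rw [tsum_stepMass]
  exact π.tsum_coe_ne_top

/-- By stationarity the state after one step again has law `π`. Avoiding `w` for `n + 1` steps means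
that this state is not `w` and that `w` is avoided for `n` further steps; the excluded state
contributes the first term. -/
theorem tsum_mul_avoidProb (Φ : G.Policy) (μ : PMF V) (π : PMF G.QueueDetail)
    (hπ : IsStationary Φ μ π) (w : G.QueueDetail) (n : ℕ) :
    π w * avoidProb Φ μ w n w + ∑' x, π x * avoidProb Φ μ w (n + 1) x =
      ∑' x, π x * avoidProb Φ μ w n x := by
  rw [ENNReal.tsum_eq_add_tsum_ite w (f := fun x => π x * avoidProb Φ μ w n x)]
  congr 1
  have h := tsum_stepMass_mul Φ μ π fun x => if x = w then 0 else avoidProb Φ μ w n x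
  simp only [(isStationary_iff Φ μ π).1 hπ] at h
  simp only [avoidProb]
  rw [← h]
  exact tsum_congr fun x => by split_ifs <;> simp

/-- The mean return time of a state is at most the inverse of its stationary probability. -/
theorem mul_tsum_avoidProb_le_one (Φ : G.Policy) (μ : PMF V) (π : PMF G.QueueDetail)
    (hπ : IsStationary Φ μ π) (w : G.QueueDetail) :
    π w * ∑' n, avoidProb Φ μ w n w ≤ 1 := by
  rw [← ENNReal.tsum_mul_left, ENNReal.tsum_eq_iSup_nat]
  refine iSup_le fun N => ?_
  -- Telescoping: the remainder is the probability of avoiding `w` for `N` steps from stationarity,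
  -- and it is nonnegative.
  have h : ∑ n ∈ Finset.range N, π w * avoidProb Φ μ w n w +
      ∑' x, π x * avoidProb Φ μ w N x = 1 := by
    induction N with
    | zero => simp [avoidProb]
    | succ N ih => rw [Finset.sum_range_succ, add_assoc, tsum_mul_avoidProb Φ μ π hπ w N, ih]
  exact h ▸ le_self_add

theorem positiveRecurrent_of_isStationary [MeasurableSpace V] [MeasurableSingletonClass V]
    (Φ : G.Policy) (μ : PMF V) (π : PMF G.QueueDetail) (hπ : IsStationary Φ μ π)
    (hpos : ∀ w, π w ≠ 0) : PositiveRecurrent Φ μ := by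
  intro w
  rw [lintegral_returnTime]
  have h := mul_tsum_avoidProb_le_one Φ μ π hπ w
  by_contra hc
  rw [not_lt, top_le_iff] at hc
  rw [hc, ENNReal.mul_top (hpos w)] at h
  simp at h

theorem stepMass_mono (Φ : G.Policy) (μ : PMF V) {f g : G.QueueDetail → ℝ≥0∞}
    (h : ∀ x, f x ≤ g x) (w : G.QueueDetail) : stepMass Φ μ f w ≤ stepMass Φ μ g w :=
  ENNReal.tsum_le_tsum fun x => by gcongr; exact h x

theorem stepMass_add (Φ : G.Policy) (μ : PMF V) (f g : G.QueueDetail → ℝ≥0∞)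
    (w : G.QueueDetail) :
    stepMass Φ μ (fun x => f x + g x) w = stepMass Φ μ f w + stepMass Φ μ g w := by
  simp only [stepMass, add_mul, ENNReal.tsum_add]

/-- Two states are linked by one step. -/
def Leads (Φ : G.Policy) (x y : G.QueueDetail) : Prop := ∃ v, Φ x v = y

/-- Every letter has positive probability, so an invariant measure passes its mass on along each
transition. -/
theorem ne_zero_of_leads (Φ : G.Policy) (μ : PMF V) (hμ : ∀ v, μ v ≠ 0)
    {f : G.QueueDetail → ℝ≥0∞} (hf : ∀ w, stepMass Φ μ f w = f w) {x y : G.QueueDetail}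
    (hxy : Relation.ReflTransGen (Leads Φ) x y) (hx : f x ≠ 0) : f y ≠ 0 := by
  induction hxy with
  | refl => exact hx
  | @tail y z _ hyz ih =>
    obtain ⟨v, rfl⟩ := hyz
    rw [← hf]
    intro h0
    rw [stepMass, ENNReal.tsum_eq_zero] at h0
    rcases mul_eq_zero.1 (h0 y) with h | h
    · exact ih h
    · rw [Finset.sum_eq_zero_iff] at h
      exact hμ v (by simpa using h v (Finset.mem_univ v))

/-- The stationary probability is unique if some state can be reached from every state. -/
theorem IsStationary.unique (Φ : G.Policy) (μ : PMF V) (hμ : ∀ v, μ v ≠ 0) (e : G.QueueDetail)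
    (he : ∀ x, Relation.ReflTransGen (Leads Φ) x e) {π π' : PMF G.QueueDetail}
    (hπ : IsStationary Φ μ π) (hπ' : IsStationary Φ μ π') : π' = π := by
  rw [isStationary_iff] at hπ hπ'
  -- The minimum of two invariant measures is subinvariant of finite mass, hence invariant. At `e`
  -- it equals one of the two; the difference to that one is invariant and vanishes at the reachable
  -- state `e`, hence everywhere.
  set ν : G.QueueDetail → ℝ≥0∞ := fun x => min (π x) (π' x) with hν
  have hνfin : ∑' x, ν x ≠ ∞ :=
    ne_top_of_le_ne_top π.tsum_coe_ne_top (ENNReal.tsum_le_tsum fun x => min_le_left _ _)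
  have hνx : ∀ x, ν x ≠ ∞ := fun x => ENNReal.ne_top_of_tsum_ne_top hνfin x
  have hνinv : ∀ w, stepMass Φ μ ν w = ν w := by
    refine eq_of_le_of_tsum_eq (fun w => le_min ?_ ?_) (tsum_stepMass Φ μ ν).ge
      (by rwa [tsum_stepMass])
    · exact (stepMass_mono Φ μ (fun x => min_le_left _ _) w).trans (hπ w).le
    · exact (stepMass_mono Φ μ (fun x => min_le_right _ _) w).trans (hπ' w).le
  have key : ∀ ρ : PMF G.QueueDetail, (∀ w, stepMass Φ μ ρ w = ρ w) → (∀ x, ν x ≤ ρ x) →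
      ν e = ρ e → ∀ x, ν x = ρ x := by
    intro ρ hρ hle hE x
    have hinv : ∀ w, stepMass Φ μ (fun x => ρ x - ν x) w = ρ w - ν w := by
      intro w
      have h := stepMass_add Φ μ ν (fun x => ρ x - ν x) w
      have h2 : (fun x => ν x + (ρ x - ν x)) = ρ := funext fun x => add_tsub_cancel_of_le (hle x)
      rw [h2, hρ, hνinv] at h
      rw [h, ENNReal.add_sub_cancel_left (hνx w)]
    by_contra hne
    refine ne_zero_of_leads Φ μ hμ hinv (he x) ?_ (by simp [hE])
    exact (tsub_pos_of_lt (lt_of_le_of_ne (hle x) hne)).ne'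
  rcases le_total (π e) (π' e) with h | h
  · have h1 := key π hπ (fun x => min_le_left _ _) (min_eq_left h)
    refine (PMF.ext fun x => eq_of_le_of_tsum_eq (f := π) (g := π') (fun x => ?_) ?_
      π.tsum_coe_ne_top x).symm
    · exact (h1 x).symm.le.trans (min_le_right _ _)
    · rw [π.tsum_coe, π'.tsum_coe]
  · have h1 := key π' hπ' (fun x => min_le_right _ _) (min_eq_right h)
    refine PMF.ext fun x => eq_of_le_of_tsum_eq (f := π') (g := π) (fun x => ?_) ?_
      π'.tsum_coe_ne_top x
    · exact (h1 x).symm.le.trans (min_le_left _ _)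
    · rw [π.tsum_coe, π'.tsum_coe]

end Chain

/-- The empty queue detail. -/
def emptyDetail (G : Multigraph V) : G.QueueDetail := ⟨[], by simp [IsQueueDetail]⟩

/-- An isolated node would be the only node, and a single node without loop is a bipartite graph. -/
theorem exists_adj (G : Multigraph V) (hconn : G.Connected) (hbip : ¬ G.IsBipartiteGraph) (v : V) :
    ∃ u, G.Adj v u := by
  by_contra h
  push Not at h
  have hall : ∀ u, u = v := by
    intro u
    induction hconn.2 v u with
    | refl => rfl
    | tail _ h' ih => subst ih; exact absurd h' (h _)
  have hno : ∀ u w, ¬ G.Adj u w := fun u w => by rw [hall u]; exact h w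
  exact hbip ⟨fun u => hno u u, ⟨fun _ => 0, fun {u w} hadj => absurd hadj.2 (hno u w)⟩⟩

theorem fcfmWord_length_le (G : Multigraph V) (w : List V) (v : V) :
    (G.fcfmWord w v).length ≤ w.length + 1 := by
  unfold fcfmWord
  split_ifs
  · exact List.eraseP_sublist.length_le.trans (Nat.le_succ _)
  · simp

/-- A neighbour of the first letter is matched with it, as it is the oldest item; the word is thus
emptied from the front. -/
theorem reflTransGen_leads_emptyDetail (G : Multigraph V) (hadj : ∀ v, ∃ u, G.Adj v u)
    (x : G.QueueDetail) : Relation.ReflTransGen (Leads G.fcfm) x G.emptyDetail := by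
  obtain ⟨w, hw⟩ := x
  induction w with
  | nil => exact Relation.ReflTransGen.refl
  | cons y w ih =>
    obtain ⟨u, hu⟩ := hadj y
    have hstep : G.fcfmWord (y :: w) u = w := by
      simp [fcfmWord, hu]
    have hw' : G.IsQueueDetail w := hstep ▸ hw.fcfmWord u
    have hlead : Leads G.fcfm ⟨y :: w, hw⟩ ⟨w, hw'⟩ := ⟨u, Subtype.ext hstep⟩
    exact Relation.ReflTransGen.head hlead (ih hw')

/-! ### The chain killed at a state -/

section Taboo

variable [Fintype V] {G : Multigraph V}

/-- One step of the chain killed at `w`, acting on functions. -/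
def tabooStep (Φ : G.Policy) (μ : PMF V) (w : G.QueueDetail) (F : G.QueueDetail → ℝ)
    (x : G.QueueDetail) : ℝ :=
  ∑ v, (μ v).toReal * if Φ x v = w then 0 else F (Φ x v)

theorem tabooStep_mono (Φ : G.Policy) (μ : PMF V) (w : G.QueueDetail) :
    Monotone (tabooStep Φ μ w) := by
  intro F F' h x
  refine Finset.sum_le_sum fun v _ => mul_le_mul_of_nonneg_left ?_ ENNReal.toReal_nonneg
  split_ifs
  · exact le_rfl
  · exact h _

theorem avoidProb_ne_top (Φ : G.Policy) (μ : PMF V) (w : G.QueueDetail) (n : ℕ)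
    (x : G.QueueDetail) : avoidProb Φ μ w n x ≠ ∞ := by
  induction n generalizing x with
  | zero => simp [avoidProb]
  | succ n ih =>
    rw [avoidProb, ENNReal.sum_ne_top]
    intro v _
    refine ENNReal.mul_ne_top (μ.apply_ne_top v) ?_
    split_ifs
    · simp
    · exact ih _

theorem toReal_avoidProb (Φ : G.Policy) (μ : PMF V) (w : G.QueueDetail) (n : ℕ) :
    (fun x => (avoidProb Φ μ w n x).toReal) = (tabooStep Φ μ w)^[n] fun _ => 1 := by
  induction n with
  | zero => funext x; simp [avoidProb]
  | succ n ih =>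
    funext x
    rw [Function.iterate_succ_apply', ← ih, avoidProb, tabooStep, ENNReal.toReal_sum]
    · refine Finset.sum_congr rfl fun v _ => ?_
      rw [ENNReal.toReal_mul]
      split_ifs <;> simp
    · intro v _
      refine ENNReal.mul_ne_top (μ.apply_ne_top v) ?_
      split_ifs
      · simp
      · exact avoidProb_ne_top _ _ _ _ _

/-- The word grows by at most one letter per step, so on the survival event `F` is at most the
initial length plus `n`. -/
theorem iterate_tabooStep_le (μ : PMF V) (w : G.QueueDetail) {F : G.QueueDetail → ℝ}
    (hF : ∀ x, F x ≤ x.1.length) (n : ℕ) (x : G.QueueDetail) :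
    (tabooStep G.fcfm μ w)^[n] F x ≤
      (x.1.length + n) * (avoidProb G.fcfm μ w n x).toReal := by
  induction n generalizing x with
  | zero => simpa [avoidProb] using hF x
  | succ n ih =>
    have h1 : (avoidProb G.fcfm μ w (n + 1) x).toReal = tabooStep G.fcfm μ w
        (fun y => (avoidProb G.fcfm μ w n y).toReal) x := by
      rw [toReal_avoidProb, ← Function.iterate_succ_apply' (tabooStep G.fcfm μ w),
        ← toReal_avoidProb]
    rw [Function.iterate_succ_apply', h1, tabooStep, tabooStep, Finset.mul_sum]
    refine Finset.sum_le_sum fun v _ => ?_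
    rw [mul_left_comm]
    refine mul_le_mul_of_nonneg_left ?_ ENNReal.toReal_nonneg
    split_ifs
    · simp
    · refine (ih _).trans (mul_le_mul_of_nonneg_right ?_ ENNReal.toReal_nonneg)
      have : ((G.fcfm x v).1.length : ℝ) ≤ x.1.length + 1 := by
        exact_mod_cast fcfmWord_length_le G x.1 v
      push_cast
      linarith

end Taboo

/-! ### Necessity of `Ncond` -/

section Necessity

/-- The number of items with class in `I`, minus the number of items with class in `J`. -/
def excess (I J : Finset V) (w : List V) : ℝ :=
  (w.map fun v => (if v ∈ I then (1 : ℝ) else 0) - if v ∈ J then 1 else 0).sum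

theorem excess_le_length (I J : Finset V) (w : List V) : excess I J w ≤ w.length := by
  induction w with
  | nil => simp [excess]
  | cons v w ih =>
    simp only [excess, List.map_cons, List.sum_cons, List.length_cons] at ih ⊢
    push_cast
    split_ifs <;> linarith

variable [Fintype V]

theorem mem_nbhd {G : Multigraph V} {U : Finset V} {v : V} :
    v ∈ G.nbhd U ↔ ∃ u ∈ U, G.Adj u v := by simp [nbhd]

/-- Equality holds if `v` is stored. If `v` is matched with `a`, membership of either one in `I`
puts the other in `G.nbhd I`, so the contributions of `a` and `v` have sum at most 0, and losing `a`
is no worse than gaining `v`. -/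
theorem excess_fcfmWord_ge (G : Multigraph V) (I : Finset V) (w : List V) (v : V) :
    excess I (G.nbhd I) w + ((if v ∈ I then 1 else 0) - if v ∈ G.nbhd I then 1 else 0) ≤
      excess I (G.nbhd I) (G.fcfmWord w v) := by
  unfold fcfmWord
  by_cases h : ∃ u ∈ w, G.Adj u v
  · rw [if_pos h]
    obtain ⟨u, hu, huv⟩ := h
    obtain ⟨a, l₁, l₂, -, hav, hw, he⟩ :=
      List.exists_of_eraseP (p := fun u => decide (G.Adj u v)) hu (by simpa using huv)
    have hav : G.Adj a v := by simpa using hav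
    rw [he, hw]
    simp only [excess, List.map_append, List.map_cons, List.sum_append, List.sum_cons]
    have h1 : a ∈ I → v ∈ G.nbhd I := fun h => mem_nbhd.2 ⟨a, h, hav⟩
    have h2 : v ∈ I → a ∈ G.nbhd I := fun h => mem_nbhd.2 ⟨v, h, G.symm _ _ hav⟩
    by_cases ha : a ∈ I <;> by_cases hv : v ∈ I <;> by_cases ha' : a ∈ G.nbhd I <;>
      by_cases hv' : v ∈ G.nbhd I <;> simp_all <;> linarith
  · rw [if_neg h]
    simp [excess]

/-- A nonempty independent set `I` of a connected non-bipartite multigraph has a neighbour with a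
neighbour outside `I`. -/
theorem exists_adj_nbhd_notMem (G : Multigraph V) (hconn : G.Connected)
    (hbip : ¬ G.IsBipartiteGraph) {I : Finset V} (hI : I ∈ G.indepSets) :
    ∃ j ∈ G.nbhd I, ∃ k ∉ I, G.Adj j k := by
  by_contra hcon
  push Not at hcon
  obtain ⟨⟨i, hi⟩, hind⟩ : I.Nonempty ∧ ∀ u ∈ I, ∀ v ∈ I, ¬ G.Adj u v := by
    simpa [indepSets] using hI
  -- If all neighbours of ℰ(I) lie in `I`, connectedness leaves no node outside I ∪ ℰ(I), and every
  -- edge joins `I` to its complement: there is no loop and the graph is bipartite.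
  have hcover : ∀ v, v ∈ I ∨ v ∈ G.nbhd I := by
    intro v
    induction hconn.2 i v with
    | refl => exact Or.inl hi
    | @tail u v _ huv ih =>
      rcases ih with hu | hu
      · exact Or.inr (mem_nbhd.2 ⟨u, hu, huv⟩)
      · by_contra hv
        exact hcon u hu v (fun h => hv (Or.inl h)) huv
  have hcross : ∀ u v, G.Adj u v → (u ∈ I ↔ v ∉ I) := by
    intro u v huv
    constructor
    · exact fun hu hv => hind u hu v hv huv
    · intro hv
      by_contra hu
      exact hcon u ((hcover u).resolve_left hu) v hv huv
  refine hbip ⟨fun v hv => ?_, ⟨fun v => if v ∈ I then 0 else 1, fun {u v} huv => ?_⟩⟩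
  · have := hcross v v hv
    tauto
  · have := hcross u v huv.2
    by_cases hu : u ∈ I <;> by_cases hv : v ∈ I <;> simp_all

theorem sum_toReal (μ : PMF V) : ∑ v, (μ v).toReal = 1 := by
  rw [← ENNReal.toReal_sum fun v _ => μ.apply_ne_top v, ← tsum_fintype (L := .unconditional _),
    μ.tsum_coe, ENNReal.toReal_one]

theorem sum_toReal_mul_ite (μ : PMF V) (A : Finset V) :
    ∑ v, (μ v).toReal * (if v ∈ A then 1 else 0) = mass μ A := by
  simp [mass]

/-- Comparison with the harmonic series. -/
theorem not_summable_of_le_natCast_mul {h : ℕ → ℝ} {c : ℝ} (hc : 0 < c) {m : ℕ}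
    (hle : ∀ n, m ≤ n → c ≤ n * h n) : ¬ Summable h := by
  intro hsum
  have h1 : Summable fun n : ℕ => 1 / ((n + (m + 1) : ℕ) : ℝ) := by
    refine Summable.of_nonneg_of_le (fun n => by positivity) (fun n => ?_)
      (((summable_nat_add_iff (m + 1)).2 hsum).mul_left c⁻¹)
    have hn : (0 : ℝ) < ((n + (m + 1) : ℕ) : ℝ) := by positivity
    rw [div_le_iff₀ hn, mul_assoc, inv_mul_eq_div, le_div_iff₀ hc, one_mul, mul_comm]
    exact hle (n + (m + 1)) (by omega)
  exact Real.not_summable_one_div_natCast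
    ((summable_nat_add_iff (f := fun n : ℕ => 1 / (n : ℝ)) (m + 1)).1 h1)

/-- A killed chain admits no positive subharmonic function that grows at most linearly, if its
mean lifetime is finite. -/
theorem iterate_tabooStep_nonpos {G : Multigraph V} (μ : PMF V) (f : G.QueueDetail → ℝ)
    (hlen : ∀ x, f x ≤ x.1.length) (hf : f ≤ tabooStep G.fcfm μ G.emptyDetail f)
    (hfin : ∑' n, avoidProb G.fcfm μ G.emptyDetail n G.emptyDetail ≠ ∞) (m : ℕ) :
    (tabooStep G.fcfm μ G.emptyDetail)^[m] f G.emptyDetail ≤ 0 := by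
  by_contra hpos
  have hmono : Monotone fun n => (tabooStep G.fcfm μ G.emptyDetail)^[n] f G.emptyDetail := by
    refine monotone_nat_of_le_succ fun n => ?_
    rw [Function.iterate_succ_apply]
    exact (tabooStep_mono G.fcfm μ G.emptyDetail).iterate n hf G.emptyDetail
  -- The iterates at the empty word are nondecreasing, so a positive value at time `m` persists as
  -- the constant `c`.
  refine not_summable_of_le_natCast_mul (not_le.1 hpos) (m := m) (fun n hn => ?_)
    (ENNReal.summable_toReal hfin)
  refine (hmono hn).trans ((iterate_tabooStep_le μ G.emptyDetail hlen n G.emptyDetail).trans ?_)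
  have h3 : G.emptyDetail.1.length = 0 := rfl
  rw [h3, Nat.cast_zero, zero_add]

/-- The excess vanishes at the empty word, so killing there changes nothing. -/
theorem tabooStep_excess (G : Multigraph V) (μ : PMF V) (I J : Finset V) (x : G.QueueDetail) :
    tabooStep G.fcfm μ G.emptyDetail (fun y => excess I J y.1) x =
      ∑ v, (μ v).toReal * excess I J (G.fcfmWord x.1 v) := by
  refine Finset.sum_congr rfl fun v _ => ?_
  split_ifs with h
  · have h' : G.fcfmWord x.1 v = [] := congrArg Subtype.val h
    simp [h', excess]
  · rfl

theorem le_sum_excess_fcfmWord (G : Multigraph V) (μ : PMF V) {I : Finset V}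
    (hle : mass μ (G.nbhd I) ≤ mass μ I) (w : List V) :
    excess I (G.nbhd I) w ≤ ∑ v, (μ v).toReal * excess I (G.nbhd I) (G.fcfmWord w v) := by
  have h := Finset.sum_le_sum (s := Finset.univ) fun v _ =>
    mul_le_mul_of_nonneg_left (excess_fcfmWord_ge G I w v) (ENNReal.toReal_nonneg (a := μ v))
  simp only [mul_add, mul_sub, Finset.sum_add_distrib, Finset.sum_sub_distrib,
    sum_toReal_mul_ite, ← Finset.sum_mul, sum_toReal, one_mul] at h
  linarith

/-- The arrival of `k` removes `j` and raises the excess from -1 to 0, whereas the general bound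
only guarantees a nonpositive increment, as `k ∉ I`. The gain of at least 1 has probability `μ k`.
-/
theorem add_le_sum_excess_fcfmWord_singleton (G : Multigraph V) (μ : PMF V) {I : Finset V}
    (hle : mass μ (G.nbhd I) ≤ mass μ I) {j k : V} (hj : j ∈ G.nbhd I) (hjI : j ∉ I)
    (hk : k ∉ I) (hjk : G.Adj j k) :
    excess I (G.nbhd I) [j] + (μ k).toReal ≤
      ∑ v, (μ v).toReal * excess I (G.nbhd I) (G.fcfmWord [j] v) := by
  have hv : ∀ v, excess I (G.nbhd I) [j] + (((if v ∈ I then 1 else 0) -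
      if v ∈ G.nbhd I then 1 else 0) + if v = k then 1 else 0) ≤
      excess I (G.nbhd I) (G.fcfmWord [j] v) := by
    intro v
    by_cases hvk : v = k
    · subst hvk
      have h1 : G.fcfmWord [j] v = [] := by simp [fcfmWord, hjk]
      rw [h1]
      simp only [excess, hj, hjI, hk, List.map_cons, List.map_nil, List.sum_cons, List.sum_nil,
        if_true, if_false]
      split_ifs <;> norm_num
    · rw [if_neg hvk, add_zero]
      exact excess_fcfmWord_ge G I [j] v
  have h := Finset.sum_le_sum (s := Finset.univ) fun v _ =>
    mul_le_mul_of_nonneg_left (hv v) (ENNReal.toReal_nonneg (a := μ v))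
  have hk1 : ∑ v, (μ v).toReal * (if v = k then 1 else 0) = (μ k).toReal := by simp
  simp only [mul_add, mul_sub, Finset.sum_add_distrib, Finset.sum_sub_distrib,
    sum_toReal_mul_ite, ← Finset.sum_mul, sum_toReal, one_mul, hk1] at h
  linarith

/-- If the buffer content is positive recurrent, then `μ` satisfies the condition `Ncond`. -/
theorem mass_lt_of_positiveRecurrent [MeasurableSpace V] [MeasurableSingletonClass V]
    (G : Multigraph V) (hconn : G.Connected) (hbip : ¬ G.IsBipartiteGraph) (μ : PMF V)
    (hμ : ∀ v, μ v ≠ 0) (hrec : PositiveRecurrent G.fcfm μ) {I : Finset V}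
    (hI : I ∈ G.indepSets) : mass μ I < mass μ (G.nbhd I) := by
  by_contra hle
  rw [not_lt] at hle
  obtain ⟨j, hj, k, hk, hjk⟩ := exists_adj_nbhd_notMem G hconn hbip hI
  have hjI : j ∉ I := by
    obtain ⟨i, hi, hij⟩ := mem_nbhd.1 hj
    simp only [indepSets, Finset.mem_filter] at hI
    exact fun h => hI.2.2 i hi j h hij
  have hpos : ∀ v, 0 < (μ v).toReal := fun v => ENNReal.toReal_pos (hμ v) (μ.apply_ne_top v)
  set f : G.QueueDetail → ℝ := fun x => excess I (G.nbhd I) x.1 with hf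
  have hfK : f ≤ tabooStep G.fcfm μ G.emptyDetail f := fun x => by
    rw [hf, tabooStep_excess]
    exact le_sum_excess_fcfmWord G μ hle x.1
  have hword : ∀ v, (G.fcfm G.emptyDetail v).1 = [v] := fun v => by
    simp [fcfm, fcfmWord, emptyDetail]
  have hne : ∀ v, G.fcfm G.emptyDetail v ≠ G.emptyDetail := fun v h => by
    have h1 := hword v
    rw [h] at h1
    simp [emptyDetail] at h1
  have hsub : ∀ v, f (G.fcfm G.emptyDetail v) + (if v = j then (μ k).toReal else 0) ≤
      tabooStep G.fcfm μ G.emptyDetail f (G.fcfm G.emptyDetail v) := by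
    intro v
    split_ifs with hv
    · subst hv
      rw [hf, tabooStep_excess]
      simp only [hword]
      exact add_le_sum_excess_fcfmWord_singleton G μ hle hj hjI hk hjk
    · rw [add_zero]
      exact hfK _
  -- The word `[j]` is reached in one step with probability `μ j`, so the strict drift there shows
  -- up in the second iterate.
  have hle2 : tabooStep G.fcfm μ G.emptyDetail f G.emptyDetail + (μ j).toReal * (μ k).toReal ≤
      tabooStep G.fcfm μ G.emptyDetail (tabooStep G.fcfm μ G.emptyDetail f) G.emptyDetail := by
    have h := Finset.sum_le_sum (s := Finset.univ) fun v _ =>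
      mul_le_mul_of_nonneg_left (hsub v) (hpos v).le
    have hj1 : ∑ v, (μ v).toReal * (if v = j then (μ k).toReal else 0) =
        (μ j).toReal * (μ k).toReal := by simp
    rw [Finset.sum_congr rfl fun v _ => mul_add _ _ _, Finset.sum_add_distrib, hj1] at h
    rw [tabooStep, tabooStep]
    simpa only [hne, if_false] using h
  have h0 : f G.emptyDetail = 0 := by simp [hf, emptyDetail, excess]
  have h1 := hfK G.emptyDetail
  have h2 := iterate_tabooStep_nonpos μ f (fun x => excess_le_length _ _ _) hfK
    (by rw [← lintegral_returnTime]; exact (hrec _).ne) 2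
  rw [Function.iterate_succ_apply', Function.iterate_one] at h2
  have h3 := mul_pos (hpos j) (hpos k)
  linarith

end Necessity

/-! ### Subinvariance of the product form -/

section ProductForm

section ListWeight

variable {M : Type*} [CommMonoid M]

/-- The product of the weights `c S x` over the letters `x` of a word, where `S` is the set of the
letters that precede `x`, including those of an initial set. -/
def listWeight (c : Finset V → V → M) : Finset V → List V → M
  | _, [] => 1
  | S, x :: l => c S x * listWeight c (insert x S) l

theorem listWeight_append (c : Finset V → V → M) (S : Finset V) (l l' : List V) :
    listWeight c S (l ++ l') = listWeight c S l * listWeight c (S ∪ l.toFinset) l' := by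
  induction l generalizing S with
  | nil => simp [listWeight]
  | cons x l ih =>
    have : insert x S ∪ l.toFinset = S ∪ (x :: l).toFinset := by
      ext y; simp only [List.toFinset_cons, Finset.mem_union, Finset.mem_insert]; tauto
    simp only [List.cons_append, listWeight, ih, mul_assoc, this]

theorem listWeight_ofFn (c : Finset V → V → M) {n : ℕ} (S : Finset V) (x : Fin n → V) :
    listWeight c S (List.ofFn x) = ∏ i, c (S ∪ (Finset.Iio i).image x) (x i) := by
  induction n generalizing S with
  | zero => simp [listWeight]
  | succ n ih =>
    rw [List.ofFn_succ, listWeight, ih, Fin.prod_univ_succ]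
    congr 1
    · congr 1
      ext y
      simp
    · refine Finset.prod_congr rfl fun i _ => ?_
      congr 1
      ext y
      simp only [Finset.mem_union, Finset.mem_insert, Finset.mem_image, Finset.mem_Iio,
        Fin.exists_fin_succ, Fin.succ_lt_succ_iff, Fin.succ_pos, true_and]
      rw [eq_comm (a := y)]
      tauto

end ListWeight

theorem insert_image_Iio {n : ℕ} (x : Fin n → V) (i : Fin n) :
    insert (x i) ((Finset.Iio i).image x) = firsts x i := by
  rw [firsts, ← Finset.image_insert]
  congr 1
  ext j
  simp [le_iff_eq_or_lt]

theorem mass_nonneg (μ : PMF V) (A : Finset V) : 0 ≤ mass μ A :=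
  Finset.sum_nonneg fun _ _ => ENNReal.toReal_nonneg

theorem mass_mono (μ : PMF V) {A B : Finset V} (h : A ⊆ B) : mass μ A ≤ mass μ B :=
  Finset.sum_le_sum_of_subset_of_nonneg h fun _ _ _ => ENNReal.toReal_nonneg

theorem ofReal_mass (μ : PMF V) (A : Finset V) : ENNReal.ofReal (mass μ A) = ∑ v ∈ A, μ v := by
  rw [mass, ENNReal.ofReal_sum_of_nonneg fun _ _ => ENNReal.toReal_nonneg]
  exact Finset.sum_congr rfl fun v _ => ENNReal.ofReal_toReal (μ.apply_ne_top v)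

theorem mass_sdiff (μ : PMF V) {A B : Finset V} (h : A ⊆ B) :
    mass μ (B \ A) = mass μ B - mass μ A := by
  rw [mass, mass, mass, ← Finset.sum_sdiff h]
  ring

theorem listWeight_nonneg {c : Finset V → V → ℝ} (hc : ∀ S x, 0 ≤ c S x) (S : Finset V)
    (l : List V) : 0 ≤ listWeight c S l := by
  induction l generalizing S with
  | nil => exact zero_le_one
  | cons x l ih => exact mul_nonneg (hc _ _) (ih _)

theorem listWeight_pos {c : Finset V → V → ℝ} (hc : ∀ S x, 0 < c S x) (S : Finset V)
    (l : List V) : 0 < listWeight c S l := by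
  induction l generalizing S with
  | nil => exact zero_lt_one
  | cons x l ih => exact mul_pos (hc _ _) (ih _)

/-- Only an inequality, since `l` need not be admissible; subinvariance needs no more. -/
theorem tsum_ite_val_eq_le {p : List V → Prop} (l : List V) (a : ℝ≥0∞) :
    (∑' x : {y : List V // p y}, if x.1 = l then a else 0) ≤ a := by
  refine (ENNReal.tsum_comp_le_tsum_of_injective Subtype.val_injective
    (fun y => if y = l then a else 0)).trans ?_
  rw [tsum_ite_eq]

variable [Fintype V]

/-- The weight of a letter `x` of a word that is preceded by the letters of `S`. -/
def letterWeight (G : Multigraph V) (μ : PMF V) (S : Finset V) (x : V) : ℝ :=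
  (μ x).toReal / mass μ (G.nbhd (insert x S))

theorem wordWeight_eq_listWeight (G : Multigraph V) (μ : PMF V) (w : List V) :
    G.wordWeight μ w = listWeight (G.letterWeight μ) ∅ w := by
  conv_rhs => rw [← List.ofFn_get w]
  rw [listWeight_ofFn, wordWeight]
  simp only [letterWeight, Finset.empty_union, insert_image_Iio]

theorem letterWeight_nonneg (G : Multigraph V) (μ : PMF V) (S : Finset V) (x : V) :
    0 ≤ G.letterWeight μ S x :=
  div_nonneg ENNReal.toReal_nonneg (mass_nonneg _ _)

theorem nbhd_mono (G : Multigraph V) {S T : Finset V} (h : S ⊆ T) : G.nbhd S ⊆ G.nbhd T := by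
  intro v hv
  obtain ⟨u, hu, huv⟩ := mem_nbhd.1 hv
  exact mem_nbhd.2 ⟨u, h hu, huv⟩

theorem mass_nbhd_insert_pos (G : Multigraph V) (μ : PMF V) (hμ : ∀ v, μ v ≠ 0)
    (hadj : ∀ v, ∃ u, G.Adj v u) (S : Finset V) (x : V) : 0 < mass μ (G.nbhd (insert x S)) := by
  obtain ⟨u, hu⟩ := hadj x
  refine Finset.sum_pos (fun v _ => ENNReal.toReal_pos (hμ v) (μ.apply_ne_top v)) ⟨u, ?_⟩
  exact mem_nbhd.2 ⟨x, Finset.mem_insert_self _ _, hu⟩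

theorem letterWeight_pos (G : Multigraph V) (μ : PMF V) (hμ : ∀ v, μ v ≠ 0)
    (hadj : ∀ v, ∃ u, G.Adj v u) (S : Finset V) (x : V) : 0 < G.letterWeight μ S x :=
  div_pos (ENNReal.toReal_pos (hμ x) (μ.apply_ne_top x)) (mass_nbhd_insert_pos G μ hμ hadj S x)

/-- Summing over all the positions where a letter `u` can be inserted into a word. -/
theorem sum_listWeight_insert (G : Multigraph V) (μ : PMF V) (hμ : ∀ v, μ v ≠ 0)
    (hadj : ∀ v, ∃ u, G.Adj v u) (u : V) (S : Finset V) (w : List V) :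
    ∑ k ∈ Finset.range (w.length + 1),
      listWeight (G.letterWeight μ) S (w.take k ++ u :: w.drop k) *
        (mass μ (G.nbhd (insert u (S ∪ (w.take k).toFinset))) -
          mass μ (G.nbhd (S ∪ (w.take k).toFinset))) =
      (μ u).toReal * (listWeight (G.letterWeight μ) S w -
        mass μ (G.nbhd S) / mass μ (G.nbhd (insert u S)) *
          listWeight (G.letterWeight μ) (insert u S) w) := by
  induction w generalizing S with
  | nil =>
    have := (mass_nbhd_insert_pos G μ hμ hadj S u).ne'
    simp [listWeight, letterWeight]
    field_simp
  | cons y w ih =>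
    have hu := (mass_nbhd_insert_pos G μ hμ hadj S u).ne'
    have hy := (mass_nbhd_insert_pos G μ hμ hadj S y).ne'
    have huy := (mass_nbhd_insert_pos G μ hμ hadj (insert y S) u).ne'
    -- Position 0, in front of `y`, is split off; the later positions insert `u` into `w` after the
    -- letters `insert y S`, where the induction hypothesis applies.
    rw [List.length_cons, Finset.sum_range_succ']
    have hS : ∀ k, S ∪ (List.take (k + 1) (y :: w)).toFinset =
        insert y S ∪ (List.take k w).toFinset := by
      intro k
      ext z; simp only [List.take_succ_cons, List.toFinset_cons, Finset.mem_union,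
        Finset.mem_insert]; tauto
    have hsum := ih (insert y S)
    simp only [hS]
    simp only [List.take_succ_cons, List.drop_succ_cons, List.cons_append, listWeight,
      List.take_zero, List.drop_zero, List.nil_append, List.toFinset_nil, Finset.union_empty,
      mul_assoc, ← Finset.mul_sum] at hsum ⊢
    rw [hsum, Finset.insert_comm y u S]
    simp only [letterWeight, Finset.insert_comm y u S] at huy ⊢
    field_simp
    ring

theorem mass_add_mass_compl (μ : PMF V) (A : Finset V) : mass μ A + mass μ Aᶜ = 1 := by
  rw [mass, mass, Finset.sum_add_sum_compl, sum_toReal]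

/-- The possible predecessors of `w`. A removed letter `u` is not in ℰ(w) because `x` is admissible,
and `v` has no neighbour in front of `u` because `u` was the oldest match. -/
theorem fcfm_eq_cases (G : Multigraph V) {x w : G.QueueDetail} {v : V} (h : G.fcfm x v = w) :
    x.1 ++ [v] = w.1 ∨ ∃ u ∈ (G.nbhd w.1.toFinset)ᶜ, ∃ k ∈ Finset.range (w.1.length + 1),
      x.1 = w.1.take k ++ u :: w.1.drop k ∧
      v ∈ G.nbhd (insert u (w.1.take k).toFinset) \ G.nbhd (w.1.take k).toFinset := by
  have hword : G.fcfmWord x.1 v = w.1 := congrArg Subtype.val h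
  unfold fcfmWord at hword
  by_cases hex : ∃ u ∈ x.1, G.Adj u v
  · rw [if_pos hex] at hword
    right
    obtain ⟨a, ha, hav⟩ := hex
    obtain ⟨u, l₁, l₂, hl₁, huv, hx, he⟩ :=
      List.exists_of_eraseP (p := fun u => decide (G.Adj u v)) ha (by simpa using hav)
    have huv : G.Adj u v := by simpa using huv
    have hw : w.1 = l₁ ++ l₂ := by rw [← hword, he]
    refine ⟨u, ?_, l₁.length, ?_, ?_, ?_⟩
    · rw [Finset.mem_compl, mem_nbhd]
      rintro ⟨y, hy, hyu⟩
      have hyw : y ∈ l₁ ++ l₂ := by rw [← hw]; simpa using hy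
      have hcu : x.1.count u = (l₁ ++ l₂).count u + 1 := by
        rw [hx]; simp [List.count_append]; omega
      -- If `y = u` carries a loop, it would occur twice in `x`.
      by_cases hyu' : y = u
      · subst hyu'
        have h1 := x.2.2 y hyu
        have h2 := List.count_pos_iff.2 hyw
        omega
      · have h1 := x.2.1 y u hyu' hyu
        have h2 := List.count_pos_iff.2 hyw
        have h3 : x.1.count y = (l₁ ++ l₂).count y := by
          rw [hx]; simp [List.count_append, Ne.symm hyu']
        rcases Nat.mul_eq_zero.1 h1 with h | h <;> omega
    · simp [hw]
    · simp [hw, hx]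
    · rw [Finset.mem_sdiff]
      refine ⟨mem_nbhd.2 ⟨u, Finset.mem_insert_self _ _, huv⟩, ?_⟩
      rw [mem_nbhd]
      rintro ⟨y, hy, hyv⟩
      have hy' : y ∈ l₁ := by simpa [hw] using hy
      exact hl₁ y hy' (by simpa using hyv)
  · rw [if_neg hex] at hword
    exact Or.inl hword

/-- The weights of the product form, at the words. -/
def productMass (G : Multigraph V) (μ : PMF V) (C : ℝ) (w : List V) : ℝ≥0∞ :=
  ENNReal.ofReal (C * listWeight (G.letterWeight μ) ∅ w)

/-- Inflow by storage: the last letter weight, multiplied by μ(ℰ(w)), is the probability of the last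
letter. -/
theorem tsum_append_le (G : Multigraph V) (μ : PMF V) (hμ : ∀ v, μ v ≠ 0)
    (hadj : ∀ v, ∃ u, G.Adj v u) {C : ℝ} (hC : 0 ≤ C) (w : List V) :
    ∑ v, ∑' x : G.QueueDetail, (if x.1 ++ [v] = w then G.productMass μ C x.1 * μ v else 0) ≤
      ENNReal.ofReal (C * listWeight (G.letterWeight μ) ∅ w * mass μ (G.nbhd w.toFinset)) := by
  rcases List.eq_nil_or_concat w with rfl | ⟨l, y, hl⟩
  · simp
  · rw [List.concat_eq_append] at hl
    subst hl
    have h1 : ∀ v, ∑' x : G.QueueDetail,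
        (if x.1 ++ [v] = l ++ [y] then G.productMass μ C x.1 * μ v else 0) ≤
        if v = y then G.productMass μ C l * μ y else 0 := by
      intro v
      split_ifs with hv
      · subst hv
        refine le_trans (ENNReal.tsum_le_tsum fun x => ?_)
          (tsum_ite_val_eq_le (p := G.IsQueueDetail) l (G.productMass μ C l * μ v))
        by_cases hx : x.1 = l
        · simp [hx]
        · simp [hx]
      · simp [hv]
    refine (Finset.sum_le_sum fun v _ => h1 v).trans ?_
    rw [Finset.sum_ite_eq' Finset.univ y, if_pos (Finset.mem_univ y), productMass,
      ← ENNReal.ofReal_toReal (μ.apply_ne_top y), ← ENNReal.ofReal_mul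
      (mul_nonneg hC (listWeight_nonneg (letterWeight_nonneg G μ) _ _))]
    refine ENNReal.ofReal_le_ofReal (le_of_eq ?_)
    have hy := (mass_nbhd_insert_pos G μ hμ hadj l.toFinset y).ne'
    have hset : (l ++ [y]).toFinset = insert y l.toFinset := by
      ext z; simp
    rw [listWeight_append, hset]
    simp only [listWeight, letterWeight, Finset.empty_union, mul_one]
    field_simp

/-- Inflow by matching: with `S = ∅` the correction term in `sum_listWeight_insert` vanishes, each
`u` contributes its mass, and the sum runs over the complement of ℰ(w). -/
theorem sum_insert_eq (G : Multigraph V) (μ : PMF V) (hμ : ∀ v, μ v ≠ 0)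
    (hadj : ∀ v, ∃ u, G.Adj v u) {C : ℝ} (hC : 0 ≤ C) (w : List V) :
    ∑ u ∈ (G.nbhd w.toFinset)ᶜ, ∑ k ∈ Finset.range (w.length + 1),
      ∑ v ∈ G.nbhd (insert u (w.take k).toFinset) \ G.nbhd (w.take k).toFinset,
        G.productMass μ C (w.take k ++ u :: w.drop k) * μ v =
      ENNReal.ofReal (C * listWeight (G.letterWeight μ) ∅ w *
        (1 - mass μ (G.nbhd w.toFinset))) := by
  have hnn := fun l => mul_nonneg hC (listWeight_nonneg (letterWeight_nonneg G μ) ∅ l)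
  have hu : ∀ u, ∑ k ∈ Finset.range (w.length + 1),
      ∑ v ∈ G.nbhd (insert u (w.take k).toFinset) \ G.nbhd (w.take k).toFinset,
        G.productMass μ C (w.take k ++ u :: w.drop k) * μ v =
      ENNReal.ofReal (C * listWeight (G.letterWeight μ) ∅ w * (μ u).toReal) := by
    intro u
    have h := sum_listWeight_insert G μ hμ hadj u ∅ w
    have h0 : mass μ (G.nbhd ∅) = 0 := by simp [mass, nbhd]
    simp only [Finset.empty_union, h0, zero_div, zero_mul, sub_zero] at h
    rw [mul_assoc, mul_comm _ (μ u).toReal, ← h, Finset.mul_sum, ENNReal.ofReal_sum_of_nonneg]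
    · refine Finset.sum_congr rfl fun k _ => ?_
      rw [← Finset.mul_sum, ← ofReal_mass, productMass, ← ENNReal.ofReal_mul (hnn _),
        mass_sdiff _ (nbhd_mono G (Finset.subset_insert _ _)), mul_assoc]
    · intro k _
      rw [← mul_assoc]
      exact mul_nonneg (hnn _)
        (sub_nonneg.2 (mass_mono μ (nbhd_mono G (Finset.subset_insert _ _))))
  rw [Finset.sum_congr rfl fun u _ => hu u, ← ENNReal.ofReal_sum_of_nonneg, ← Finset.mul_sum]
  · congr 2
    have := mass_add_mass_compl μ (G.nbhd w.toFinset)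
    rw [← mass]
    linarith
  · exact fun u _ => mul_nonneg (hnn _) ENNReal.toReal_nonneg

/-- The product form is subinvariant. -/
theorem stepMass_productMass_le (G : Multigraph V) (μ : PMF V) (hμ : ∀ v, μ v ≠ 0)
    (hadj : ∀ v, ∃ u, G.Adj v u) {C : ℝ} (hC : 0 ≤ C) (w : G.QueueDetail) :
    stepMass G.fcfm μ (fun x => G.productMass μ C x.1) w ≤ G.productMass μ C w.1 := by
  set D : V → ℕ → Finset V := fun u k =>
    G.nbhd (insert u (w.1.take k).toFinset) \ G.nbhd (w.1.take k).toFinset with hD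
  have hpt : ∀ (v : V) (x : G.QueueDetail),
      (if G.fcfm x v = w then G.productMass μ C x.1 * μ v else 0) ≤
      (if x.1 ++ [v] = w.1 then G.productMass μ C x.1 * μ v else 0) +
      ∑ u ∈ (G.nbhd w.1.toFinset)ᶜ, ∑ k ∈ Finset.range (w.1.length + 1),
        if v ∈ D u k then (if x.1 = w.1.take k ++ u :: w.1.drop k then
          G.productMass μ C (w.1.take k ++ u :: w.1.drop k) * μ v else 0) else 0 := by
    intro v x
    split_ifs with h1 h2 h2
    · exact le_self_add
    · obtain h | ⟨u, hu, k, hk, hx, hv⟩ := fcfm_eq_cases G h1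
      · exact absurd h h2
      · rw [zero_add]
        refine le_trans ?_ (Finset.single_le_sum (fun _ _ => zero_le) hu)
        refine le_trans ?_ (Finset.single_le_sum (fun _ _ => zero_le) hk)
        rw [if_pos hv, if_pos hx, hx]
    · exact zero_le
    · exact zero_le
  have hstep : stepMass G.fcfm μ (fun x => G.productMass μ C x.1) w =
      ∑ v, ∑' x : G.QueueDetail,
        if G.fcfm x v = w then G.productMass μ C x.1 * μ v else 0 := by
    rw [stepMass, ← Summable.tsum_finsetSum fun _ _ => ENNReal.summable]
    refine tsum_congr fun x => ?_
    rw [Finset.mul_sum]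
    refine Finset.sum_congr rfl fun v _ => ?_
    split_ifs <;> simp
  have hins : ∀ v, ∑' x : G.QueueDetail,
      ∑ u ∈ (G.nbhd w.1.toFinset)ᶜ, ∑ k ∈ Finset.range (w.1.length + 1),
        (if v ∈ D u k then (if x.1 = w.1.take k ++ u :: w.1.drop k then
          G.productMass μ C (w.1.take k ++ u :: w.1.drop k) * μ v else 0) else 0) ≤
      ∑ u ∈ (G.nbhd w.1.toFinset)ᶜ, ∑ k ∈ Finset.range (w.1.length + 1),
        if v ∈ D u k then G.productMass μ C (w.1.take k ++ u :: w.1.drop k) * μ v else 0 := by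
    intro v
    rw [Summable.tsum_finsetSum fun _ _ => ENNReal.summable]
    refine Finset.sum_le_sum fun u _ => ?_
    rw [Summable.tsum_finsetSum fun _ _ => ENNReal.summable]
    refine Finset.sum_le_sum fun k _ => ?_
    split_ifs
    · exact tsum_ite_val_eq_le _ _
    · simp
  rw [hstep]
  calc _ ≤ ∑ v, ((∑' x : G.QueueDetail,
          if x.1 ++ [v] = w.1 then G.productMass μ C x.1 * μ v else 0) +
        ∑ u ∈ (G.nbhd w.1.toFinset)ᶜ, ∑ k ∈ Finset.range (w.1.length + 1),
          if v ∈ D u k then G.productMass μ C (w.1.take k ++ u :: w.1.drop k) * μ v else 0) := by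
        refine Finset.sum_le_sum fun v _ => (ENNReal.tsum_le_tsum (hpt v)).trans ?_
        rw [ENNReal.tsum_add]
        exact add_le_add le_rfl (hins v)
    _ ≤ ENNReal.ofReal (C * listWeight (G.letterWeight μ) ∅ w.1 *
          mass μ (G.nbhd w.1.toFinset)) + ENNReal.ofReal (C *
            listWeight (G.letterWeight μ) ∅ w.1 * (1 - mass μ (G.nbhd w.1.toFinset))) := by
        rw [Finset.sum_add_distrib]
        refine add_le_add (tsum_append_le G μ hμ hadj hC w.1) (le_of_eq ?_)
        rw [← sum_insert_eq G μ hμ hadj hC w.1, Finset.sum_comm]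
        refine Finset.sum_congr rfl fun u _ => ?_
        rw [Finset.sum_comm]
        refine Finset.sum_congr rfl fun k _ => ?_
        rw [← Finset.sum_filter, Finset.filter_mem_eq_inter, Finset.univ_inter]
    _ = G.productMass μ C w.1 := by
        have hnn := mul_nonneg hC (listWeight_nonneg (letterWeight_nonneg G μ) ∅ w.1)
        have h1 := mass_add_mass_compl μ (G.nbhd w.1.toFinset)
        have h2 := mass_nonneg μ (G.nbhd w.1.toFinset)ᶜ
        rw [← ENNReal.ofReal_add (mul_nonneg hnn (mass_nonneg _ _))
          (mul_nonneg hnn (by linarith)), productMass]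
        congr 1
        ring

end ProductForm

/-! ### Total mass of the product form -/

section Total

section ListSum

/-- A word is empty, or consists of a first letter and a word. -/
def listEquiv (V : Type*) : Unit ⊕ (V × List V) ≃ List V where
  toFun := Sum.elim (fun _ => []) fun p => p.1 :: p.2
  invFun l := match l with
    | [] => Sum.inl ()
    | x :: l => Sum.inr (x, l)
  left_inv := by rintro (_ | ⟨x, l⟩) <;> rfl
  right_inv := by rintro (_ | ⟨x, l⟩) <;> rfl

variable [Fintype V]

theorem tsum_list (F : List V → ℝ≥0∞) :
    ∑' l, F l = F [] + ∑ x, ∑' l, F (x :: l) := by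
  rw [← (listEquiv V).tsum_eq F, ← tsum_fintype (L := .unconditional _),
    ← ENNReal.tsum_prod (f := fun x l => F (x :: l))]
  refine (HasSum.sum ?_ ENNReal.summable.hasSum).tsum_eq
  have h := hasSum_fintype fun _ : Unit => F []
  rwa [Finset.univ_unique, Finset.sum_singleton] at h

/-- The total weight of all the words, after an initial set of letters. -/
def listSum (c : Finset V → V → ℝ≥0∞) (S : Finset V) : ℝ≥0∞ := ∑' l, listWeight c S l

theorem listSum_eq (c : Finset V → V → ℝ≥0∞) (S : Finset V) :
    listSum c S = 1 + ∑ x, c S x * listSum c (insert x S) := by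
  rw [listSum, tsum_list]
  simp only [listWeight, ENNReal.tsum_mul_left, listSum]

/-- The total weight is the smallest superharmonic function. -/
theorem listSum_le (c : Finset V → V → ℝ≥0∞) (P : Finset V → Prop) (R : Finset V → ℝ≥0∞)
    (hP : ∀ S x, P S → c S x ≠ 0 → P (insert x S))
    (hR : ∀ S, P S → 1 + ∑ x, c S x * R (insert x S) ≤ R S) {S : Finset V} (hS : P S) :
    listSum c S ≤ R S := by
  -- Truncation by length permits induction through the first letter; a finite set of words has
  -- bounded length.
  have htrunc : ∀ n S, P S →
      ∑' l : List V, (if l.length < n then listWeight c S l else 0) ≤ R S := by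
    intro n
    induction n with
    | zero => intro S _; simp
    | succ n ih =>
      intro S hS
      refine le_trans ?_ (hR S hS)
      rw [tsum_list]
      refine add_le_add (by simp [listWeight]) (Finset.sum_le_sum fun x _ => ?_)
      have : ∀ l : List V, (if (x :: l).length < n + 1 then listWeight c S (x :: l) else 0) =
          c S x * if l.length < n then listWeight c (insert x S) l else 0 := by
        intro l
        simp [listWeight]
      simp only [this, ENNReal.tsum_mul_left]
      by_cases hx : c S x = 0
      · simp [hx]
      · gcongr
        exact ih _ (hP S x hS hx)
  rw [listSum, ENNReal.tsum_eq_iSup_sum]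
  refine iSup_le fun F => le_trans ?_ (htrunc (F.sup List.length + 1) S hS)
  refine le_trans (Finset.sum_le_sum fun l hl => ?_) (ENNReal.sum_le_tsum F)
  rw [if_pos (Nat.lt_succ_of_le (Finset.le_sup hl))]

end ListSum

/-- No two distinct elements of `S` are adjacent. -/
def LooseIndep (G : Multigraph V) (S : Finset V) : Prop :=
  ∀ u ∈ S, ∀ v ∈ S, u ≠ v → ¬ G.Adj u v

theorem looseIndep_empty {G : Multigraph V} : G.LooseIndep ∅ :=
  fun u hu => absurd hu (Finset.notMem_empty u)

theorem LooseIndep.mono {G : Multigraph V} {S T : Finset V} (hT : G.LooseIndep T) (h : S ⊆ T) :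
    G.LooseIndep S :=
  fun u hu v hv => hT u (h hu) v (h hv)

theorem enum_comp_injective (I : Finset V) (σ : Equiv.Perm (Fin #I)) :
    Function.Injective fun j => enum I (σ j) :=
  (Subtype.val_injective.comp I.equivFin.symm.injective).comp σ.injective

theorem image_enum_comp (I : Finset V) (σ : Equiv.Perm (Fin #I)) :
    Finset.univ.image (fun j => enum I (σ j)) = I := by
  ext v
  simp only [Finset.mem_image, Finset.mem_univ, true_and]
  constructor
  · rintro ⟨j, rfl⟩
    exact (I.equivFin.symm (σ j)).2
  · intro hv
    exact ⟨σ.symm (I.equivFin ⟨v, hv⟩), by simp [enum]⟩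

theorem exists_perm_ofFn_eq {I : Finset V} {l : List V} (hl : l.Nodup) (hI : l.toFinset = I) :
    ∃ σ : Equiv.Perm (Fin #I), List.ofFn (fun j => enum I (σ j)) = l := by
  obtain ⟨n, x, rfl⟩ : ∃ (n : ℕ) (x : Fin n → V), l = List.ofFn x :=
    ⟨l.length, l.get, (List.ofFn_get l).symm⟩
  have hn : n = #I := by rw [← hI, List.toFinset_card_of_nodup hl, List.length_ofFn]
  subst hn
  have hinj : Function.Injective x := List.nodup_ofFn.1 hl
  have hmem : ∀ i, x i ∈ I := fun i => by rw [← hI]; simp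
  have hσ : Function.Injective fun i => I.equivFin ⟨x i, hmem i⟩ := by
    intro i j hij
    exact hinj (congrArg Subtype.val (I.equivFin.injective hij))
  refine ⟨Equiv.ofBijective _ (Finite.injective_iff_bijective.1 hσ), ?_⟩
  congr 1
  funext j
  simp [enum]

variable [Fintype V]

theorem LooseIndep.insert {G : Multigraph V} {S : Finset V} (hS : G.LooseIndep S) {x : V}
    (hx : x ∉ G.nbhd S) : G.LooseIndep (insert x S) := by
  intro u hu v hv huv hadj
  rw [mem_nbhd] at hx
  push Not at hx
  rcases Finset.mem_insert.1 hu with rfl | hu' <;> rcases Finset.mem_insert.1 hv with rfl | hv'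
  · exact huv rfl
  · exact hx v hv' (G.symm _ _ hadj)
  · exact hx u hu' hadj
  · exact hS u hu' v hv' huv hadj

theorem LooseIndep.mem_nbhd_iff {G : Multigraph V} {S : Finset V} (hS : G.LooseIndep S) {x : V}
    (hx : x ∈ S) : x ∈ G.nbhd S ↔ x ∉ G.loopless := by
  simp only [mem_nbhd, loopless, Finset.mem_filter, Finset.mem_univ, true_and, not_not]
  constructor
  · rintro ⟨u, hu, hux⟩
    by_cases h : u = x
    · rwa [h] at hux
    · exact absurd hux (hS u hu x hx h)
  · exact fun h => ⟨x, hx, h⟩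

theorem mem_maxSubgraphIndepSets {G : Multigraph V} {I : Finset V} :
    I ∈ G.maxSubgraphIndepSets ↔ I.Nonempty ∧ G.LooseIndep I := by
  simp only [maxSubgraphIndepSets, Finset.mem_filter, Finset.mem_univ, true_and, LooseIndep,
    SimpleGraph.IsIndepSet, Set.Pairwise, Finset.mem_coe, maxSubgraph]
  refine and_congr_right fun _ => ⟨fun h u hu v hv huv ha => h hu hv huv ⟨huv, ha⟩,
    fun h u hu v hv huv ha => h u hu v hv huv ha.2⟩

/-! ### From admissible words to orderings of independent sets -/

section Normalisation

variable (G : Multigraph V) (μ : PMF V)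

/-- The weight of a letter `x` after the letters of `S`, in an admissible word. -/
def admWeight (S : Finset V) (x : V) : ℝ≥0∞ :=
  if x ∈ G.nbhd S then 0 else ENNReal.ofReal (G.letterWeight μ S x)

/-- The weight of a new letter `x` after the letters of `S`, in an admissible word. -/
def newWeight (S : Finset V) (x : V) : ℝ≥0∞ :=
  if x ∈ S ∪ G.nbhd S then 0 else ENNReal.ofReal (G.letterWeight μ S x)

/-- The mass `μ(ℰ(S)) - μ(S ∩ V₂)`. -/
def massGap (S : Finset V) : ℝ := mass μ (G.nbhd S) - mass μ (S ∩ G.loopless)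

/-- The weight of a letter `x` after the letters of `S`, in a word without repetition. -/
def orderWeight (S : Finset V) (x : V) : ℝ≥0∞ :=
  if x ∈ S ∪ G.nbhd S then 0 else ENNReal.ofReal ((μ x).toReal / G.massGap μ (insert x S))

/-- The ratio `μ(S ∩ V₂) / μ(ℰ(S))`. -/
def loadRatio (S : Finset V) : ℝ := mass μ (S ∩ G.loopless) / mass μ (G.nbhd S)

variable {G μ}

/-- `Ncond` applies to S ∩ V₂, which is independent in G itself. If this set is empty, the gap is
just μ(ℰ(S)). -/
theorem massGap_pos (hμ : μ ∈ G.Ncond) (hadj : ∀ v, ∃ u, G.Adj v u) {S : Finset V}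
    (hS : G.LooseIndep S) (hne : S.Nonempty) : 0 < G.massGap μ S := by
  have hμ0 : ∀ v, μ v ≠ 0 := fun v => (μ.mem_support_iff v).1 (by rw [hμ.1]; trivial)
  rw [massGap, sub_pos]
  rcases (S ∩ G.loopless).eq_empty_or_nonempty with h | h
  · rw [h]
    obtain ⟨x, hx⟩ := hne
    have := mass_nbhd_insert_pos G μ hμ0 hadj S x
    rw [Finset.insert_eq_of_mem hx] at this
    simpa [mass] using this
  · refine lt_of_lt_of_le (hμ.2 _ ?_) (mass_mono μ (nbhd_mono G Finset.inter_subset_left))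
    simp only [indepSets, Finset.mem_filter, Finset.mem_univ, true_and]
    refine ⟨h, fun u hu v hv huv => ?_⟩
    rw [Finset.mem_inter] at hu hv
    by_cases h : u = v
    · subst h
      simp only [loopless, Finset.mem_filter] at hu
      exact hu.2.2 huv
    · exact hS u hu.1 v hv.1 h huv

theorem loadRatio_nonneg (S : Finset V) : 0 ≤ G.loadRatio μ S :=
  div_nonneg (mass_nonneg _ _) (mass_nonneg _ _)

theorem mass_nbhd_pos_of_massGap_pos {S : Finset V} (h : 0 < G.massGap μ S) :
    0 < mass μ (G.nbhd S) := by
  have := mass_nonneg μ (S ∩ G.loopless)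
  rw [massGap] at h
  linarith

theorem one_sub_loadRatio {S : Finset V} (h : 0 < G.massGap μ S) :
    1 - G.loadRatio μ S = G.massGap μ S / mass μ (G.nbhd S) := by
  have := (mass_nbhd_pos_of_massGap_pos h).ne'
  rw [loadRatio, massGap]
  field_simp

theorem one_sub_loadRatio_pos (hμ : μ ∈ G.Ncond) (hadj : ∀ v, ∃ u, G.Adj v u) {S : Finset V}
    (hS : G.LooseIndep S) : 0 < 1 - G.loadRatio μ S := by
  rcases S.eq_empty_or_nonempty with rfl | hne
  · simp [loadRatio, mass]
  · have h := massGap_pos hμ hadj hS hne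
    rw [one_sub_loadRatio h]
    exact div_pos h (mass_nbhd_pos_of_massGap_pos h)

theorem orderWeight_mul (hμ : μ ∈ G.Ncond) (hadj : ∀ v, ∃ u, G.Adj v u) {S : Finset V}
    (hS : G.LooseIndep S) (x : V) :
    G.orderWeight μ S x * ENNReal.ofReal (1 - G.loadRatio μ (insert x S)) =
      G.newWeight μ S x := by
  rw [orderWeight, newWeight]
  split_ifs with h
  · simp
  · rw [Finset.mem_union, not_or] at h
    have hgap := massGap_pos hμ hadj (hS.insert h.2) (Finset.insert_nonempty x S)
    have hE := mass_nbhd_pos_of_massGap_pos hgap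
    rw [← ENNReal.ofReal_mul (div_nonneg ENNReal.toReal_nonneg hgap.le), one_sub_loadRatio hgap,
      letterWeight]
    congr 1
    field_simp

theorem newWeight_mul (hμ : μ ∈ G.Ncond) (hadj : ∀ v, ∃ u, G.Adj v u) {S : Finset V}
    (hS : G.LooseIndep S) (x : V) :
    G.newWeight μ S x * ENNReal.ofReal (1 - G.loadRatio μ (insert x S))⁻¹ =
      G.orderWeight μ S x := by
  by_cases h : x ∈ S ∪ G.nbhd S
  · simp [newWeight, orderWeight, h]
  · have hx : x ∉ G.nbhd S := fun hx => h (Finset.mem_union_right _ hx)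
    have hpos := one_sub_loadRatio_pos hμ hadj (hS.insert hx)
    rw [← orderWeight_mul hμ hadj hS x, mul_assoc, ← ENNReal.ofReal_mul hpos.le,
      mul_inv_cancel₀ hpos.ne', ENNReal.ofReal_one, mul_one]

/-- A letter of `S` can be repeated exactly when it has no loop, and repeating it leaves `S`
unchanged; hence the geometric ratio `loadRatio`. -/
theorem sum_admWeight_mul {S : Finset V} (hS : G.LooseIndep S) (F : Finset V → ℝ≥0∞) :
    ∑ x, G.admWeight μ S x * F (insert x S) =
      ENNReal.ofReal (G.loadRatio μ S) * F S + ∑ x, G.newWeight μ S x * F (insert x S) := by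
  have hpt : ∀ x, G.admWeight μ S x * F (insert x S) =
      (if x ∈ S ∩ G.loopless then ENNReal.ofReal ((μ x).toReal / mass μ (G.nbhd S)) else 0) * F S
        + G.newWeight μ S x * F (insert x S) := by
    intro x
    by_cases hx : x ∈ S
    · have hiff := hS.mem_nbhd_iff hx
      by_cases hl : x ∈ G.loopless
      · have hn : x ∉ G.nbhd S := fun h => hiff.1 h hl
        simp [admWeight, newWeight, hx, hl, hn, letterWeight, Finset.insert_eq_of_mem hx]
      · have hn : x ∈ G.nbhd S := hiff.2 hl
        simp [admWeight, newWeight, hl, hn]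
    · simp [admWeight, newWeight, hx]
  rw [Finset.sum_congr rfl fun x _ => hpt x, Finset.sum_add_distrib, ← Finset.sum_mul]
  congr 2
  rw [← Finset.sum_filter, Finset.filter_mem_eq_inter, Finset.univ_inter,
    ← ENNReal.ofReal_sum_of_nonneg fun x _ => div_nonneg ENNReal.toReal_nonneg (mass_nonneg _ _),
    ← Finset.sum_div]
  rfl

/-- The factor (1 - ρ)⁻¹, with ρ the load ratio, sums the repetitions before the next new letter.
The right-hand side solves the first-letter equation of the left one, which is its smallest
solution. -/
theorem listSum_admWeight_le (hμ : μ ∈ G.Ncond) (hadj : ∀ v, ∃ u, G.Adj v u) {S : Finset V}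
    (hS : G.LooseIndep S) : listSum (G.admWeight μ) S ≤
      ENNReal.ofReal (1 - G.loadRatio μ S)⁻¹ * listSum (G.orderWeight μ) S := by
  refine listSum_le (G.admWeight μ) G.LooseIndep (fun S => ENNReal.ofReal
    (1 - G.loadRatio μ S)⁻¹ * listSum (G.orderWeight μ) S) (fun S x hS hx => ?_)
    (fun S hS => le_of_eq ?_) hS
  · refine hS.insert fun h => hx ?_
    simp [admWeight, h]
  · have hpos := one_sub_loadRatio_pos hμ hadj hS
    have hsum : ∑ x, G.newWeight μ S x * (ENNReal.ofReal (1 - G.loadRatio μ (insert x S))⁻¹ *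
        listSum (G.orderWeight μ) (insert x S)) =
        ∑ x, G.orderWeight μ S x * listSum (G.orderWeight μ) (insert x S) :=
      Finset.sum_congr rfl fun x _ => by rw [← mul_assoc, newWeight_mul hμ hadj hS]
    rw [sum_admWeight_mul hS (fun S => ENNReal.ofReal
      (1 - G.loadRatio μ S)⁻¹ * listSum (G.orderWeight μ) S), hsum, add_left_comm,
      ← listSum_eq, ← mul_assoc, ← ENNReal.ofReal_mul (loadRatio_nonneg S)]
    nth_rewrite 2 [← one_mul (listSum (G.orderWeight μ) S)]
    rw [← add_mul, ← ENNReal.ofReal_one, ← ENNReal.ofReal_add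
      (mul_nonneg (loadRatio_nonneg S) (inv_pos.2 hpos).le) zero_le_one]
    congr 2
    field_simp
    ring

theorem listSum_orderWeight_le (hμ : μ ∈ G.Ncond) (hadj : ∀ v, ∃ u, G.Adj v u) {S : Finset V}
    (hS : G.LooseIndep S) : listSum (G.orderWeight μ) S ≤
      ENNReal.ofReal (1 - G.loadRatio μ S) * listSum (G.admWeight μ) S := by
  refine listSum_le (G.orderWeight μ) G.LooseIndep (fun S => ENNReal.ofReal
    (1 - G.loadRatio μ S) * listSum (G.admWeight μ) S) (fun S x hS hx => ?_)
    (fun S hS => ?_) hS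
  · refine hS.insert fun h => hx ?_
    simp [orderWeight, h]
  · have hpos := one_sub_loadRatio_pos hμ hadj hS
    have hsum : ∑ x, G.orderWeight μ S x * (ENNReal.ofReal (1 - G.loadRatio μ (insert x S)) *
        listSum (G.admWeight μ) (insert x S)) =
        ∑ x, G.newWeight μ S x * listSum (G.admWeight μ) (insert x S) :=
      Finset.sum_congr rfl fun x _ => by rw [← mul_assoc, orderWeight_mul hμ hadj hS]
    rw [hsum]
    -- The load ratio term is cancelled from the first-letter equation, which requires finiteness;
    -- the infinite case is trivial.
    by_cases htop : listSum (G.admWeight μ) S = ∞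
    · rw [htop, ENNReal.mul_top (by simpa using hpos)]
      exact le_top
    · have h1 := listSum_eq (G.admWeight μ) S
      rw [sum_admWeight_mul hS, add_left_comm] at h1
      have h2 : ENNReal.ofReal (G.loadRatio μ S) * listSum (G.admWeight μ) S +
          ENNReal.ofReal (1 - G.loadRatio μ S) * listSum (G.admWeight μ) S =
          listSum (G.admWeight μ) S := by
        rw [← add_mul, ← ENNReal.ofReal_add (loadRatio_nonneg S) hpos.le]
        simp
      refine le_of_eq ((ENNReal.add_right_inj
        (ENNReal.mul_ne_top ENNReal.ofReal_ne_top htop)).1 (h1.symm.trans h2.symm))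

theorem listSum_admWeight_empty (hμ : μ ∈ G.Ncond) (hadj : ∀ v, ∃ u, G.Adj v u) :
    listSum (G.admWeight μ) ∅ = listSum (G.orderWeight μ) ∅ := by
  -- The quotient is 0/0, which is 0 by convention.
  have h0 : G.loadRatio μ ∅ = 0 := by simp [loadRatio, mass]
  refine le_antisymm ?_ ?_
  · simpa [h0] using listSum_admWeight_le hμ hadj looseIndep_empty
  · simpa [h0] using listSum_orderWeight_le hμ hadj looseIndep_empty

/-- Admissibility can be checked letter by letter, so it can be encoded in the weights `admWeight`;
a repeated letter with a loop is its own neighbour. -/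
theorem isQueueDetail_append_singleton {l : List V} {x : V} :
    G.IsQueueDetail (l ++ [x]) ↔ G.IsQueueDetail l ∧ x ∉ G.nbhd l.toFinset := by
  have hmem : x ∉ G.nbhd l.toFinset ↔ ¬ ∃ u ∈ l, G.Adj u x := by
    simp [mem_nbhd]
  rw [hmem]
  constructor
  · intro h
    have hle : ∀ i, l.count i ≤ (l ++ [x]).count i :=
      fun i => (List.sublist_append_left l [x]).count_le i
    refine ⟨⟨fun i j hij ha => Nat.le_zero.1
      ((Nat.mul_le_mul (hle i) (hle j)).trans (h.1 i j hij ha).le),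
      fun i hi => (hle i).trans (h.2 i hi)⟩, ?_⟩
    rintro ⟨u, hu, hux⟩
    have hpos := List.count_pos_iff.2 hu
    have hx : (l ++ [x]).count x = l.count x + 1 := by simp
    by_cases hne : u = x
    · subst hne
      have := h.2 u hux
      omega
    · have h1 := h.1 u x hne hux
      have h2 := hle u
      rcases Nat.mul_eq_zero.1 h1 with h | h <;> omega
  · rintro ⟨h, hx⟩
    have := h.fcfmWord x
    rwa [fcfmWord, if_neg hx] at this

theorem listWeight_admWeight (l : List V) :
    listWeight (G.admWeight μ) ∅ l =
      if G.IsQueueDetail l then ENNReal.ofReal (listWeight (G.letterWeight μ) ∅ l) else 0 := by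
  induction l using List.reverseRecOn with
  | nil =>
    have : G.IsQueueDetail [] := G.emptyDetail.2
    simp [listWeight, this]
  | append_singleton l x ih =>
    rw [listWeight_append, ih, listWeight_append, ENNReal.ofReal_mul
      (listWeight_nonneg (letterWeight_nonneg G μ) _ _)]
    simp only [isQueueDetail_append_singleton, listWeight, admWeight, Finset.empty_union, mul_one]
    by_cases h1 : G.IsQueueDetail l <;> by_cases h2 : x ∈ G.nbhd l.toFinset <;> simp [h1, h2]

theorem tsum_productMass {C : ℝ} (hC : 0 ≤ C) :
    ∑' w : G.QueueDetail, G.productMass μ C w.1 =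
      ENNReal.ofReal C * listSum (G.admWeight μ) ∅ := by
  simp only [productMass, ENNReal.ofReal_mul hC, ENNReal.tsum_mul_left, listSum,
    listWeight_admWeight]
  congr 1
  exact tsum_subtype {l | G.IsQueueDetail l}
    fun l => ENNReal.ofReal (listWeight (G.letterWeight μ) ∅ l)

theorem nodup_of_listWeight_orderWeight_ne_zero {l : List V}
    (h : listWeight (G.orderWeight μ) ∅ l ≠ 0) : l.Nodup ∧ G.LooseIndep l.toFinset := by
  induction l using List.reverseRecOn with
  | nil => exact ⟨List.nodup_nil, looseIndep_empty⟩
  | append_singleton l x ih =>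
    rw [listWeight_append] at h
    obtain ⟨h1, h2⟩ := ne_zero_and_ne_zero_of_mul h
    obtain ⟨hn, hi⟩ := ih h1
    have hx : x ∉ l.toFinset ∪ G.nbhd l.toFinset := by
      intro hx
      simp only [listWeight, orderWeight, Finset.empty_union, mul_one] at h2
      exact h2 (if_pos hx)
    rw [Finset.mem_union, not_or, List.mem_toFinset] at hx
    have hset : (l ++ [x]).toFinset = insert x l.toFinset := by
      ext z; simp
    refine ⟨?_, hset ▸ hi.insert hx.2⟩
    rw [List.nodup_append]
    refine ⟨hn, List.nodup_singleton x, ?_⟩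
    intro a ha b hb
    rw [List.mem_singleton] at hb
    subst hb
    rintro rfl
    exact hx.1 ha

theorem listWeight_orderWeight_ofFn (hμ : μ ∈ G.Ncond) (hadj : ∀ v, ∃ u, G.Adj v u)
    {n : ℕ} {x : Fin n → V} (hinj : Function.Injective x)
    (hx : G.LooseIndep (Finset.univ.image x)) :
    listWeight (G.orderWeight μ) ∅ (List.ofFn x) =
      ENNReal.ofReal (∏ i, (μ (x i)).toReal / G.massGap μ (firsts x i)) := by
  have hsub : ∀ i, firsts x i ⊆ Finset.univ.image x :=
    fun i => Finset.image_subset_image (Finset.subset_univ _)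
  rw [listWeight_ofFn, ENNReal.ofReal_prod_of_nonneg]
  · refine Finset.prod_congr rfl fun i _ => ?_
    rw [Finset.empty_union, orderWeight, insert_image_Iio, if_neg]
    rw [Finset.mem_union, not_or]
    constructor
    · intro h
      obtain ⟨j, hj, hji⟩ := Finset.mem_image.1 h
      exact (Finset.mem_Iio.1 hj).ne (hinj hji)
    · intro h
      obtain ⟨u, hu, hux⟩ := mem_nbhd.1 h
      obtain ⟨j, hj, rfl⟩ := Finset.mem_image.1 hu
      refine hx (x j) (Finset.mem_image_of_mem _ (Finset.mem_univ _)) (x i)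
        (Finset.mem_image_of_mem _ (Finset.mem_univ _)) ?_ hux
      exact fun h => (Finset.mem_Iio.1 hj).ne (hinj h)
  · intro i _
    refine div_nonneg ENNReal.toReal_nonneg (massGap_pos hμ hadj (hx.mono (hsub i)) ?_).le
    exact ⟨x i, Finset.mem_image_of_mem _ (Finset.mem_Iic.2 le_rfl)⟩

/-- `orderWeight` kills repetitions, so only the orderings of `I` contribute. -/
theorem tsum_toFinset_eq (hμ : μ ∈ G.Ncond) (hadj : ∀ v, ∃ u, G.Adj v u) {I : Finset V}
    (hI : G.LooseIndep I) :
    (∑' l : List V, if l.toFinset = I then listWeight (G.orderWeight μ) ∅ l else 0) =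
      ∑ σ : Equiv.Perm (Fin #I), ENNReal.ofReal (∏ i, (μ (enum I (σ i))).toReal /
        G.massGap μ (firsts (fun j => enum I (σ j)) i)) := by
  have hinj : Function.Injective
      fun σ : Equiv.Perm (Fin #I) => List.ofFn fun j => enum I (σ j) := by
    intro σ τ h
    ext j
    have h1 := congrFun (List.ofFn_injective h) j
    exact congrArg Fin.val (I.equivFin.symm.injective (Subtype.val_injective h1))
  rw [tsum_eq_sum (s := Finset.univ.image
    fun σ : Equiv.Perm (Fin #I) => List.ofFn fun j => enum I (σ j))]
  · rw [Finset.sum_image hinj.injOn]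
    refine Finset.sum_congr rfl fun σ _ => ?_
    have himg := image_enum_comp I σ
    have hset : (List.ofFn fun j => enum I (σ j)).toFinset = I := by
      refine Eq.trans ?_ himg
      ext v
      simp [List.mem_ofFn]
    rw [if_pos hset, listWeight_orderWeight_ofFn hμ hadj (enum_comp_injective I σ) (by rwa [himg])]
  · intro l hl
    by_contra hne
    have hlI : l.toFinset = I := by
      by_contra h
      exact hne (if_neg h)
    rw [if_pos hlI] at hne
    obtain ⟨σ, hσ⟩ := exists_perm_ofFn_eq (nodup_of_listWeight_orderWeight_ne_zero hne).1 hlI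
    exact hl (Finset.mem_image.2 ⟨σ, Finset.mem_univ _, hσ⟩)

theorem prod_div_massGap_nonneg (hμ : μ ∈ G.Ncond) (hadj : ∀ v, ∃ u, G.Adj v u) {I : Finset V}
    (hI : G.LooseIndep I) (σ : Equiv.Perm (Fin #I)) :
    0 ≤ ∏ i, (μ (enum I (σ i))).toReal / G.massGap μ (firsts (fun j => enum I (σ j)) i) := by
  refine Finset.prod_nonneg fun i _ => div_nonneg ENNReal.toReal_nonneg
    (massGap_pos hμ hadj (hI.mono ?_) ?_).le
  · conv_rhs => rw [← image_enum_comp I σ]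
    exact Finset.image_subset_image (Finset.subset_univ _)
  · exact ⟨enum I (σ i), Finset.mem_image_of_mem (fun j => enum I (σ j)) (Finset.mem_Iic.2 le_rfl)⟩

theorem listSum_orderWeight_empty (hμ : μ ∈ G.Ncond) (hadj : ∀ v, ∃ u, G.Adj v u) :
    listSum (G.orderWeight μ) ∅ = ENNReal.ofReal (G.normConst μ)⁻¹ := by
  have hsplit : listSum (G.orderWeight μ) ∅ = ∑ I : Finset V, ∑' l : List V,
      if l.toFinset = I then listWeight (G.orderWeight μ) ∅ l else 0 := by
    rw [← Summable.tsum_finsetSum fun _ _ => ENNReal.summable, listSum]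
    exact tsum_congr fun l => by simp
  have hzero : ∀ I : Finset V, ¬ G.LooseIndep I →
      (∑' l : List V, if l.toFinset = I then listWeight (G.orderWeight μ) ∅ l else 0) = 0 := by
    intro I hI
    rw [ENNReal.tsum_eq_zero]
    intro l
    split_ifs with hl
    · by_contra hne
      exact hI (hl ▸ (nodup_of_listWeight_orderWeight_ne_zero hne).2)
    · rfl
  have hone : (∑' l : List V,
      if l.toFinset = ∅ then listWeight (G.orderWeight μ) ∅ l else 0) = 1 := by
    rw [tsum_eq_single []]
    · simp [listWeight]
    · intro l hl
      rw [if_neg]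
      simpa using hl
  have hempty : ∅ ∉ G.maxSubgraphIndepSets := fun h => by
    simpa using (mem_maxSubgraphIndepSets.1 h).1
  have hterm := fun I (hI : I ∈ G.maxSubgraphIndepSets) =>
    tsum_toFinset_eq hμ hadj (mem_maxSubgraphIndepSets.1 hI).2
  have hnn := fun I (hI : I ∈ G.maxSubgraphIndepSets) =>
    prod_div_massGap_nonneg hμ hadj (mem_maxSubgraphIndepSets.1 hI).2
  have hconst : (G.normConst μ)⁻¹ = 1 + ∑ I ∈ G.maxSubgraphIndepSets,
      ∑ σ : Equiv.Perm (Fin #I), ∏ i, (μ (enum I (σ i))).toReal /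
        G.massGap μ (firsts (fun j => enum I (σ j)) i) := by
    rw [normConst, inv_inv]
    rfl
  rw [hsplit, ← Finset.sum_subset (Finset.subset_univ (insert ∅ G.maxSubgraphIndepSets)),
    Finset.sum_insert hempty, hone, Finset.sum_congr rfl hterm, hconst,
    ENNReal.ofReal_add zero_le_one
      (Finset.sum_nonneg fun I hI => Finset.sum_nonneg fun σ _ => hnn I hI σ), ENNReal.ofReal_one,
    ENNReal.ofReal_sum_of_nonneg fun I hI => Finset.sum_nonneg fun σ _ => hnn I hI σ]
  · congr 1
    refine Finset.sum_congr rfl fun I hI => ?_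
    exact (ENNReal.ofReal_sum_of_nonneg fun σ _ => hnn I hI σ).symm
  · intro I _ hI
    apply hzero
    rw [Finset.mem_insert, not_or] at hI
    exact fun h => hI.2 (mem_maxSubgraphIndepSets.2 ⟨Finset.nonempty_iff_ne_empty.2 hI.1, h⟩)

/-- The empty word alone contributes 1 to the total weight. -/
theorem normConst_pos (hμ : μ ∈ G.Ncond) (hadj : ∀ v, ∃ u, G.Adj v u) : 0 < G.normConst μ := by
  have h1 : (1 : ℝ≥0∞) ≤ ENNReal.ofReal (G.normConst μ)⁻¹ := by
    rw [← listSum_orderWeight_empty hμ hadj, listSum_eq]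
    exact le_self_add
  exact inv_pos.1 (ENNReal.ofReal_pos.1 (zero_lt_one.trans_le h1))

/-- The probability with the product form. -/
def productPMF (hμ : μ ∈ G.Ncond) (hadj : ∀ v, ∃ u, G.Adj v u) : PMF G.QueueDetail :=
  ⟨fun w => G.productMass μ (G.normConst μ) w.1, by
    have hpos := normConst_pos hμ hadj
    have h : ∑' w : G.QueueDetail, G.productMass μ (G.normConst μ) w.1 = 1 := by
      rw [tsum_productMass hpos.le, listSum_admWeight_empty hμ hadj,
        listSum_orderWeight_empty hμ hadj, ← ENNReal.ofReal_mul hpos.le,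
        mul_inv_cancel₀ hpos.ne', ENNReal.ofReal_one]
    exact h ▸ ENNReal.summable.hasSum⟩

theorem productPMF_apply (hμ : μ ∈ G.Ncond) (hadj : ∀ v, ∃ u, G.Adj v u) (w : G.QueueDetail) :
    productPMF hμ hadj w = G.productMass μ (G.normConst μ) w.1 := rfl

end Normalisation

end Total

end Multigraph

end

/-! ### Maximality of FCFM and its stationary law -/

theorem mainTheorem1 {V : Type*} [Fintype V] [MeasurableSpace V] [MeasurableSingletonClass V]
    (G : Multigraph V) (hconn : G.Connected) (hbip : ¬ G.IsBipartiteGraph) :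
    G.Stab G.fcfm = G.Ncond ∧
    ∀ μ ∈ G.Ncond, ∃ π : PMF G.QueueDetail,
      Multigraph.IsStationary G.fcfm μ π ∧
      (∀ π' : PMF G.QueueDetail, Multigraph.IsStationary G.fcfm μ π' → π' = π) ∧
      ∀ w : G.QueueDetail, (π w).toReal = G.normConst μ * G.wordWeight μ w.1 := by
  have hadj := G.exists_adj hconn hbip
  have hμ0 : ∀ μ ∈ Multigraph.exactSupport V, ∀ v, μ v ≠ 0 := fun μ hμ v =>
    (μ.mem_support_iff v).1 (by rw [hμ]; trivial)
  have hstat : ∀ μ (hμ : μ ∈ G.Ncond),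
      Multigraph.IsStationary G.fcfm μ (Multigraph.productPMF hμ hadj) := fun μ hμ =>
    Multigraph.isStationary_of_stepMass_le _ _ _ fun w =>
      G.stepMass_productMass_le μ (hμ0 μ hμ.1) hadj (Multigraph.normConst_pos hμ hadj).le w
  have hpos : ∀ μ (_ : μ ∈ G.Ncond) (w : List V),
      0 < G.normConst μ * Multigraph.listWeight (G.letterWeight μ) ∅ w := fun μ hμ w =>
    mul_pos (Multigraph.normConst_pos hμ hadj)
      (Multigraph.listWeight_pos (G.letterWeight_pos μ (hμ0 μ hμ.1) hadj) _ _)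
  refine ⟨Set.Subset.antisymm ?_ ?_, fun μ hμ => ⟨Multigraph.productPMF hμ hadj, hstat μ hμ,
    fun π' hπ' => (hstat μ hμ).unique _ _ (hμ0 μ hμ.1) G.emptyDetail
      (G.reflTransGen_leads_emptyDetail hadj) hπ', fun w => ?_⟩⟩
  · rintro μ ⟨hμ, hrec⟩
    exact ⟨hμ, fun I hI => G.mass_lt_of_positiveRecurrent hconn hbip μ (hμ0 μ hμ) hrec hI⟩
  · intro μ hμ
    refine ⟨hμ.1, Multigraph.positiveRecurrent_of_isStationary _ _ _ (hstat μ hμ) fun w => ?_⟩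
    exact (ENNReal.ofReal_pos.2 (hpos μ hμ w.1)).ne'
  · rw [Multigraph.productPMF_apply, Multigraph.productMass,
      ENNReal.toReal_ofReal (hpos μ hμ w.1).le, G.wordWeight_eq_listWeight]
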